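/- Let $N\ge 1$ and $0\le N_1\le N$ be integers and let $p_1,\dots,p_N$ be real numbers with $p_i=1$ for $i\le N_1$ and $p_i>1$ for $i>N_1$. Assume $N_1+\sum_{i>N_1}\frac1{p_i}>1$, put $$p^*=\frac{N}{N_1+\sum_{i>N_1}\frac1{p_i}-1},$$ and assume $\max_i p_i<p^*$. Write $q'=q/(q-1)$ for $q>1$, $\mathcal D(\mathbb R^N)$ for the smooth compactly supported functions, and $\nabla_1=(\partial_1,\dots,\partial_{N_1})$. A Radon measure on $\mathbb R^N$ is an element of the dual of $\mathcal C_c(\mathbb R^N)$; if $\mu=(\mu_1,\dots,\mu_n)$ is a vector of Radon measures, $|\mu|$ is the positive measure given, for $\varphi\ge0$ in $\mathcal C_c(\mathbb R^N)$, by $$\langle|\mu|,\varphi\rangle=\sup\Big\{\sum_i\langle\mu_i,\psi_i\rangle:\ \psi_i\in\mathcal C_c(\mathbb R^N),\ \sum_i\psi_i^2\le\varphi^2\Big\}.$$ Let $BV^{\vec p}(\mathbb R^N)$ be the set of $u\in L^{p^*}(\mathbb R^N)$ whose distributional derivatives satisfy: $\partial_iu$ is a bounded Radon measure for $i\le N_1$,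 and $\partial_iu\in L^{p_i}(\mathbb R^N)$ for $i>N_1$. Let $BV^{\vec p}_{loc}(\mathbb R^N)$ be the set of $u$ such that $\varphi u\in BV^{\vec p}(\mathbb R^N)$ for every $\varphi\in\mathcal D(\mathbb R^N)$. **Theorem.** Let $\sigma:\mathbb R^N\to\mathbb R^N$ be such that its projection $\sigma^1$ on the first $N_1$ coordinates is in $L^\infty_{loc}(\mathbb R^N,\mathbb R^{N_1})$, $\sigma_i\in L^{p_i'}_{loc}(\mathbb R^N)$ for $i>N_1$, and the distributional divergence $\operatorname{div}\sigma$ is in $L^{p^*/(p^*-1)}_{loc}(\mathbb R^N)$. Let $u\in BV^{\vec p}_{loc}(\mathbb R^N)$. Then: 1. For every $\varphi\in\mathcal D(\mathbb R^N)$ the functions $(\operatorname{div}\sigma)\,u\varphi$ and $(\sigma\cdot\nabla\varphi)\,u$ are integrable, and $$\langle\sigma\cdot\nabla u,\varphi\rangle=-\int_{\mathbb R^N}(\operatorname{div}\sigma)\,u\varphi-\int_{\mathbb R^N}(\sigma\cdot\nabla\varphi)\,u$$ defines a distribution $\sigma\cdot\nabla u$, which is a Radon measure. 2. $\nabla_1u$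 is a vector of $N_1$ Radon measures, and for $i>N_1$ one has $\partial_iu\in L^{p_i}_{loc}(\mathbb R^N)$ and $\sigma_i\partial_iu\in L^1_{loc}(\mathbb R^N)$. The Radon measure $$\sigma^1\cdot\nabla_1u:=\sigma\cdot\nabla u-\sum_{i>N_1}\sigma_i\,\partial_iu$$ is absolutely continuous with respect to $|\nabla_1u|$, and for every $\varphi\ge0$ in $\mathcal C_c(\mathbb R^N)$ $$\langle|\sigma^1\cdot\nabla_1u|,\varphi\rangle\le\|\sigma^1\|_{L^\infty(\operatorname{supp}\varphi)}\,\langle|\nabla_1u|,\varphi\rangle .$$ 3. If moreover $\sigma^1\in L^\infty(\mathbb R^N,\mathbb R^{N_1})$, $\sigma_i\in L^{p_i'}(\mathbb R^N)$ for $i>N_1$, $\operatorname{div}\sigma\in L^{p^*/(p^*-1)}(\mathbb R^N)$ and $u\in BV^{\vec p}(\mathbb R^N)$, then $\sigma\cdot\nabla u$ and $\sigma^1\cdot\nabla_1u$ are bounded measures, $(\operatorname{div}\sigma)\,u$ is integrable, $$\int_{\mathbb R^N}\sigma\cdot\nabla u=-\int_{\mathbb R^N}(\operatorname{div}\sigma)\,u\qquad\text{and}\qquad|\sigma^1\cdot\nabla_1u|\le\|\sigma^1\|_{L^\infty(\mathbb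 R^N)}\,|\nabla_1u|\quad\text{as measures.}$$ -/

import Mathlib

open MeasureTheory Set TopologicalSpace
open scoped ENNReal NNReal CompactlySupported Distributions

namespace AnisoBV

noncomputable section

/-! ### Scalar and vector Radon measures as elements of the dual of `C_c` -/

/-- A (signed, not necessarily bounded) scalar Radon measure on `X`, i.e. an element of the dual of
`C_c(X)`: a linear form which, on each compact set `K`, is bounded on the functions supported
in `K` and bounded by `1` (equivalently `|L φ| ≤ C_K sup |φ|` whenever `supp φ ⊆ K`). -/
structure RadonMeasure (X : Type*) [TopologicalSpace X] where
  toLin : C_c(X, ℝ) →ₗ[ℝ] ℝ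
  bound : ∀ K : Set X, IsCompact K → ∃ C : ℝ, ∀ φ : C_c(X, ℝ),
    tsupport φ ⊆ K → (∀ x, |φ x| ≤ 1) → |toLin φ| ≤ C

section TotalVariation

variable {X : Type*} [TopologicalSpace X] {ι : Type*} [Fintype ι]

/-- The numbers `∑ i, ⟨μ i, ψ i⟩`, with `ψ i ∈ C_c(X)` and `∑ i, (ψ i)² ≤ φ²`. -/
def tvSet (μ : ι → RadonMeasure X) (φ : C_c(X, ℝ≥0)) : Set ℝ :=
  {r | ∃ ψ : ι → C_c(X, ℝ), (∀ x, ∑ i, ψ i x ^ 2 ≤ (φ x : ℝ) ^ 2) ∧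
    r = ∑ i, (μ i).toLin (ψ i)}

/-- `⟨|μ|, φ⟩ = sup {∑ i, ⟨μ i, ψ i⟩ : ψ i ∈ C_c(X), ∑ i, (ψ i)² ≤ φ²}` for `φ ≥ 0`. -/
def tvSup (μ : ι → RadonMeasure X) (φ : C_c(X, ℝ≥0)) : ℝ := sSup (tvSet μ φ)

theorem zero_mem_tvSet (μ : ι → RadonMeasure X) (φ : C_c(X, ℝ≥0)) : (0 : ℝ) ∈ tvSet μ φ :=
  ⟨fun _ => 0, fun x => by simp, by simp⟩

theorem bddAbove_tvSet (μ : ι → RadonMeasure X) (φ : C_c(X, ℝ≥0)) : BddAbove (tvSet μ φ) := by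
  obtain ⟨B, hB⟩ : ∃ B : ℝ, ∀ x, ‖(φ x : ℝ)‖ ≤ B := by
    have h1 : Continuous fun x => (φ x : ℝ) := by fun_prop
    have h2 : HasCompactSupport fun x => (φ x : ℝ) :=
      φ.hasCompactSupport.comp_left (g := fun t : ℝ≥0 => (t : ℝ)) NNReal.coe_zero
    exact h1.bounded_above_of_compact_support h2
  have hB' : ∀ x, (φ x : ℝ) ≤ |B| + 1 := fun x => by
    have h1 := (le_abs_self _).trans (hB x)
    have h2 := le_abs_self B
    linarith
  have hpos : 0 < |B| + 1 := by positivity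
  have hK : IsCompact (tsupport φ) := φ.hasCompactSupport
  choose C hC using fun i => (μ i).bound (tsupport φ) hK
  refine ⟨∑ i, (|B| + 1) * C i, ?_⟩
  rintro r ⟨ψ, hψ, rfl⟩
  refine Finset.sum_le_sum fun i _ => ?_
  have hle : ∀ x, |ψ i x| ≤ φ x := fun x => by
    refine abs_le_of_sq_le_sq ?_ (φ x).coe_nonneg
    exact (Finset.single_le_sum (f := fun i => ψ i x ^ 2) (fun j _ => sq_nonneg _)
      (Finset.mem_univ i)).trans (hψ x)
  have key := hC i ((|B| + 1)⁻¹ • ψ i) ?_ ?_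
  · rw [map_smul, smul_eq_mul, abs_mul, abs_of_pos (inv_pos.2 hpos),
      inv_mul_le_iff₀ hpos] at key
    exact (le_abs_self _).trans key
  · refine closure_mono fun x hx => ?_
    rw [Function.mem_support] at hx ⊢
    intro h0
    apply hx
    have := hle x
    rw [h0, NNReal.coe_zero] at this
    have h1 : ψ i x = 0 := abs_nonpos_iff.1 this
    simp [h1]
  · intro x
    rw [CompactlySupportedContinuousMap.smul_apply, smul_eq_mul, abs_mul,
      abs_of_pos (inv_pos.2 hpos), inv_mul_le_iff₀ hpos, mul_one]
    exact (hle x).trans (hB' x)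

theorem tvSup_nonneg (μ : ι → RadonMeasure X) (φ : C_c(X, ℝ≥0)) : 0 ≤ tvSup μ φ :=
  le_csSup (bddAbove_tvSet μ φ) (zero_mem_tvSet μ φ)

theorem smul_mem_tvSet (μ : ι → RadonMeasure X) (φ : C_c(X, ℝ≥0)) (c : ℝ≥0) {r : ℝ}
    (hr : r ∈ tvSet μ φ) : (c : ℝ) * r ∈ tvSet μ (c • φ) := by
  obtain ⟨ψ, hψ, rfl⟩ := hr
  refine ⟨fun i => (c : ℝ) • ψ i, fun x => ?_, ?_⟩
  · have := mul_le_mul_of_nonneg_left (hψ x) (sq_nonneg (c : ℝ))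
    simpa [mul_pow, Finset.mul_sum] using this
  · simp [Finset.mul_sum]

theorem tvSup_smul (μ : ι → RadonMeasure X) (c : ℝ≥0) (φ : C_c(X, ℝ≥0)) :
    tvSup μ (c • φ) = c * tvSup μ φ := by
  have hle : ∀ (c : ℝ≥0) (φ : C_c(X, ℝ≥0)), 0 < c → c * tvSup μ φ ≤ tvSup μ (c • φ) := by
    intro c φ hc
    have hc' : (0 : ℝ) < c := by exact_mod_cast hc
    rw [← le_div_iff₀' hc']
    refine csSup_le ⟨0, zero_mem_tvSet μ φ⟩ fun r hr => ?_
    rw [le_div_iff₀' hc']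
    exact le_csSup (bddAbove_tvSet _ _) (smul_mem_tvSet μ φ c hr)
  rcases eq_or_lt_of_le (zero_le (a := c)) with rfl | hc
  · simp only [zero_smul, NNReal.coe_zero, zero_mul]
    refine le_antisymm (csSup_le ⟨0, zero_mem_tvSet μ _⟩ ?_) (tvSup_nonneg _ _)
    rintro r ⟨ψ, hψ, rfl⟩
    refine le_of_eq (Finset.sum_eq_zero fun i _ => ?_)
    have : ψ i = 0 := by
      ext x
      have h1 := (Finset.single_le_sum (f := fun i => ψ i x ^ 2) (fun j _ => sq_nonneg _)
        (Finset.mem_univ i)).trans (hψ x)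
      simp only [CompactlySupportedContinuousMap.zero_apply, NNReal.coe_zero] at h1 ⊢
      nlinarith [sq_nonneg (ψ i x)]
    rw [this, map_zero]
  · refine le_antisymm ?_ (hle c φ hc)
    have hc' : (0 : ℝ) < c := by exact_mod_cast hc
    have h := hle c⁻¹ (c • φ) (inv_pos.2 hc)
    rw [smul_smul, inv_mul_cancel₀ hc.ne', one_smul, NNReal.coe_inv, inv_mul_le_iff₀ hc'] at h
    exact h

theorem add_mem_tvSet (μ : ι → RadonMeasure X) (φ₁ φ₂ : C_c(X, ℝ≥0)) {r₁ r₂ : ℝ}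
    (h₁ : r₁ ∈ tvSet μ φ₁) (h₂ : r₂ ∈ tvSet μ φ₂) : r₁ + r₂ ∈ tvSet μ (φ₁ + φ₂) := by
  obtain ⟨ψ, hψ, rfl⟩ := h₁
  obtain ⟨χ, hχ, rfl⟩ := h₂
  refine ⟨fun i => ψ i + χ i, fun x => ?_, by simp [Finset.sum_add_distrib]⟩
  have hcs : (∑ i, ψ i x * χ i x) ≤ φ₁ x * φ₂ x := by
    refine le_of_abs_le (abs_le_of_sq_le_sq ?_ (by positivity))
    calc (∑ i, ψ i x * χ i x) ^ 2 ≤ (∑ i, ψ i x ^ 2) * ∑ i, χ i x ^ 2 :=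
          Finset.sum_mul_sq_le_sq_mul_sq _ _ _
      _ ≤ (φ₁ x : ℝ) ^ 2 * (φ₂ x : ℝ) ^ 2 :=
          mul_le_mul (hψ x) (hχ x) (Finset.sum_nonneg fun _ _ => sq_nonneg _) (sq_nonneg _)
      _ = (φ₁ x * φ₂ x : ℝ) ^ 2 := by ring
  have hexp : ∑ i, (ψ i + χ i) x ^ 2
      = ∑ i, ψ i x ^ 2 + 2 * ∑ i, ψ i x * χ i x + ∑ i, χ i x ^ 2 := by
    rw [Finset.mul_sum, ← Finset.sum_add_distrib, ← Finset.sum_add_distrib]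
    refine Finset.sum_congr rfl fun i _ => ?_
    rw [CompactlySupportedContinuousMap.add_apply]
    ring
  rw [hexp, CompactlySupportedContinuousMap.add_apply, NNReal.coe_add]
  nlinarith [hψ x, hχ x]

/-- A component of `ψ` is split in proportion to the two parts of `φ₁ + φ₂`. -/
theorem exists_split (φ₁ φ₂ : C_c(X, ℝ≥0)) (ψ : ι → C_c(X, ℝ))
    (hψ : ∀ x, ∑ i, ψ i x ^ 2 ≤ ((φ₁ + φ₂) x : ℝ) ^ 2) :
    ∃ χ : ι → C_c(X, ℝ), ∀ i x, χ i x = (φ₁ x : ℝ) / (φ₁ x + φ₂ x) * ψ i x := by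
  have hle : ∀ i x, |ψ i x| ≤ φ₁ x + φ₂ x := fun i x => by
    refine abs_le_of_sq_le_sq ?_ (by positivity)
    exact (Finset.single_le_sum (f := fun i => ψ i x ^ 2) (fun j _ => sq_nonneg _)
      (Finset.mem_univ i)).trans (by simpa using hψ x)
  have hcont : ∀ i, Continuous fun x => (φ₁ x : ℝ) / (φ₁ x + φ₂ x) * ψ i x := by
    intro i
    rw [continuous_iff_continuousAt]
    intro x
    by_cases hx : (φ₁ x : ℝ) + φ₂ x = 0
    · have h0 : ψ i x = 0 := abs_nonpos_iff.1 (hx ▸ hle i x)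
      have : Filter.Tendsto (fun y => |ψ i y|) (nhds x) (nhds 0) := by
        have h1 : Continuous fun y => |ψ i y| := (ψ i).continuous.abs
        have h2 := h1.tendsto x
        simpa only [h0, abs_zero] using h2
      unfold ContinuousAt
      simp only [h0, mul_zero]
      refine squeeze_zero_norm (fun y => ?_) this
      rw [norm_mul, Real.norm_eq_abs, Real.norm_eq_abs]
      refine mul_le_of_le_one_left (abs_nonneg _) ?_
      rw [abs_of_nonneg (by positivity)]
      refine div_le_one_of_le₀ ?_ (by positivity)
      linarith [(φ₂ y).coe_nonneg]
    · have c1 : Continuous fun x => (φ₁ x : ℝ) := by fun_prop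
      have c2 : Continuous fun x => (φ₂ x : ℝ) := by fun_prop
      exact (c1.continuousAt.div (c1.add c2).continuousAt hx).mul (ψ i).continuous.continuousAt
  refine ⟨fun i => ⟨⟨_, hcont i⟩, (ψ i).hasCompactSupport.mul_left⟩, fun i x => rfl⟩

theorem tvSup_add (μ : ι → RadonMeasure X) (φ₁ φ₂ : C_c(X, ℝ≥0)) :
    tvSup μ (φ₁ + φ₂) = tvSup μ φ₁ + tvSup μ φ₂ := by
  refine le_antisymm ?_ ?_
  · refine csSup_le ⟨0, zero_mem_tvSet μ _⟩ ?_
    rintro r ⟨ψ, hψ, rfl⟩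
    obtain ⟨χ, hχ⟩ := exists_split φ₁ φ₂ ψ hψ
    have hle : ∀ x, ∑ i, ψ i x ^ 2 ≤ ((φ₁ x : ℝ) + φ₂ x) ^ 2 := fun x => by simpa using hψ x
    have h1 : ∑ i, (μ i).toLin (χ i) ∈ tvSet μ φ₁ := by
      refine ⟨χ, fun x => ?_, rfl⟩
      simp only [hχ, mul_pow, ← Finset.mul_sum]
      by_cases hx : (φ₁ x : ℝ) + φ₂ x = 0
      · rw [hx]; simp
      · calc _ ≤ ((φ₁ x : ℝ) / (φ₁ x + φ₂ x)) ^ 2 * ((φ₁ x : ℝ) + φ₂ x) ^ 2 :=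
              mul_le_mul_of_nonneg_left (hle x) (sq_nonneg _)
          _ = (φ₁ x : ℝ) ^ 2 := by rw [← mul_pow, div_mul_cancel₀ _ hx]
    have h2 : ∑ i, (μ i).toLin (ψ i - χ i) ∈ tvSet μ φ₂ := by
      refine ⟨fun i => ψ i - χ i, fun x => ?_, rfl⟩
      by_cases hx : (φ₁ x : ℝ) + φ₂ x = 0
      · have h0 : ∀ i, ψ i x = 0 := fun i => by
          have h3 := (Finset.single_le_sum (f := fun i => ψ i x ^ 2) (fun j _ => sq_nonneg _)
            (Finset.mem_univ i)).trans (hle x)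
          rw [hx] at h3
          nlinarith [sq_nonneg (ψ i x)]
        simp [hχ, h0]
      · have h3 : ∀ i, (ψ i - χ i) x = (φ₂ x : ℝ) / (φ₁ x + φ₂ x) * ψ i x := fun i => by
          rw [CompactlySupportedContinuousMap.sub_apply, hχ]
          field_simp
          ring
        simp only [h3, mul_pow, ← Finset.mul_sum]
        calc _ ≤ ((φ₂ x : ℝ) / (φ₁ x + φ₂ x)) ^ 2 * ((φ₁ x : ℝ) + φ₂ x) ^ 2 :=
              mul_le_mul_of_nonneg_left (hle x) (sq_nonneg _)
          _ = (φ₂ x : ℝ) ^ 2 := by rw [← mul_pow, div_mul_cancel₀ _ hx]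
    have h3 := le_csSup (bddAbove_tvSet μ φ₁) h1
    have h4 := le_csSup (bddAbove_tvSet μ φ₂) h2
    have h5 : ∑ i, (μ i).toLin (ψ i)
        = ∑ i, (μ i).toLin (χ i) + ∑ i, (μ i).toLin (ψ i - χ i) := by
      simp
    rw [h5]
    exact add_le_add h3 h4
  · rw [← le_sub_iff_add_le]
    refine csSup_le ⟨0, zero_mem_tvSet μ _⟩ fun r₁ h₁ => ?_
    rw [le_sub_iff_add_le, ← le_sub_iff_add_le']
    refine csSup_le ⟨0, zero_mem_tvSet μ _⟩ fun r₂ h₂ => ?_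
    rw [le_sub_iff_add_le']
    exact le_csSup (bddAbove_tvSet _ _) (add_mem_tvSet μ φ₁ φ₂ h₁ h₂)

/-- `φ ↦ ⟨|μ|, φ⟩` as a linear form on the cone of nonnegative functions of `C_c(X)`. -/
def tvLin (μ : ι → RadonMeasure X) : C_c(X, ℝ≥0) →ₗ[ℝ≥0] ℝ≥0 where
  toFun φ := ⟨tvSup μ φ, tvSup_nonneg μ φ⟩
  map_add' φ₁ φ₂ := NNReal.eq (tvSup_add μ φ₁ φ₂)
  map_smul' c φ := NNReal.eq (tvSup_smul μ c φ)

variable [T2Space X] [LocallyCompactSpace X] [MeasurableSpace X] [BorelSpace X]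

/-- The total variation `|μ|` of a vector Radon measure `μ`, as a positive Borel measure: the
regular Borel measure given by the linear form `φ ↦ ⟨|μ|, φ⟩`. -/
def totalVariation (μ : ι → RadonMeasure X) : Measure X := NNRealRMK.rieszMeasure (tvLin μ)

theorem lintegral_totalVariation (μ : ι → RadonMeasure X) (φ : C_c(X, ℝ≥0)) :
    ∫⁻ x, φ x ∂(totalVariation μ) = ENNReal.ofReal (tvSup μ φ) := by
  rw [totalVariation, NNRealRMK.lintegral_rieszMeasure,
    ENNReal.ofReal_eq_coe_nnreal (tvSup_nonneg μ φ)]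
  rfl

/-- The total variation of a scalar Radon measure. -/
def RadonMeasure.abs (μ : RadonMeasure X) : Measure X := totalVariation fun _ : Unit => μ

end TotalVariation

/-- The integral of a function against a bounded signed Borel measure. -/
def signedIntegral {X : Type*} [MeasurableSpace X] (s : SignedMeasure X) (f : X → ℝ) : ℝ :=
  ∫ x, f x ∂s.toJordanDecomposition.posPart - ∫ x, f x ∂s.toJordanDecomposition.negPart

/-- The Radon measure `μ` is the bounded measure `s`. -/
def RadonMeasure.IsBoundedMeasure {X : Type*} [TopologicalSpace X] [MeasurableSpace X]
    (μ : RadonMeasure X) (s : SignedMeasure X) : Prop :=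
  ∀ φ : C_c(X, ℝ), μ.toLin φ = signedIntegral s φ

/-! ### Distributions and the spaces `BV^p` -/

/-- `ℝ^N` with its Euclidean norm. -/
abbrev Euc (N : ℕ) : Type := EuclideanSpace ℝ (Fin N)

/-- The test functions on `ℝ^N`. -/
abbrev Test (N : ℕ) : Type := 𝓓((⊤ : Opens (Euc N)), ℝ)

/-- A test function as an element of `C_c(ℝ^N)`. -/
def Test.toCc {N : ℕ} (φ : Test N) : C_c(Euc N, ℝ) := ⟨⟨φ, φ.continuous⟩, φ.hasCompactSupport⟩

/-- The partial derivative `∂_i φ`. -/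
def partialDeriv {N : ℕ} (i : Fin N) (φ : Euc N → ℝ) (x : Euc N) : ℝ :=
  fderiv ℝ φ x (EuclideanSpace.single i 1)

/-- `v ∈ L^q_loc(ℝ^N)`. -/
def MemLpLoc {N : ℕ} {F : Type*} [NormedAddCommGroup F] (v : Euc N → F) (q : ℝ≥0∞) : Prop :=
  ∀ K : Set (Euc N), IsCompact K → MemLp v q (volume.restrict K)

/-- The distributional derivative `∂_i u` is the function `d`. -/
def IsWeakPartial {N : ℕ} (i : Fin N) (u d : Euc N → ℝ) : Prop :=
  ∀ φ : Test N, ∫ x, d x * φ x = -∫ x, u x * partialDeriv i φ x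

/-- The distributional derivative `∂_i u` is the Radon measure `μ`. -/
def IsRadonPartial {N : ℕ} (i : Fin N) (u : Euc N → ℝ) (μ : RadonMeasure (Euc N)) : Prop :=
  ∀ φ : Test N, μ.toLin φ.toCc = -∫ x, u x * partialDeriv i φ x

/-- The distributional derivative `∂_i u` is the bounded measure `s`. -/
def IsBoundedPartial {N : ℕ} (i : Fin N) (u : Euc N → ℝ) (s : SignedMeasure (Euc N)) : Prop :=
  ∀ φ : Test N, signedIntegral s φ = -∫ x, u x * partialDeriv i φ x

/-- `σ · ∇φ`. -/
def dotGrad {N : ℕ} (σ : Euc N → Euc N) (φ : Euc N → ℝ) (x : Euc N) : ℝ :=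
  ∑ i, σ x i * partialDeriv i φ x

/-- The distributional divergence of `σ` is the function `g`. -/
def IsWeakDiv {N : ℕ} (σ : Euc N → Euc N) (g : Euc N → ℝ) : Prop :=
  ∀ φ : Test N, ∫ x, g x * φ x = -∫ x, dotGrad σ φ x

/-- `N / p^* = N₁ + ∑_{i > N₁} 1 / p_i - 1`; the components of index `i > N₁` are those with
`N₁ ≤ i` when indices start at `0`. -/
def invExp {N : ℕ} (N₁ : ℕ) (p : Fin N → ℝ) : ℝ :=
  (N₁ : ℝ) + ∑ i ∈ Finset.univ.filter (fun i : Fin N => N₁ ≤ (i : ℕ)), 1 / p i - 1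

/-- The critical exponent `p^*`. -/
def pStar {N : ℕ} (N₁ : ℕ) (p : Fin N → ℝ) : ℝ := (N : ℝ) / invExp N₁ p

/-- The conjugate exponent `q / (q - 1)` of a real number `q > 1`. -/
def conj (q : ℝ) : ℝ≥0∞ := ENNReal.ofReal (q / (q - 1))

/-- The projection `σ^1` of `σ` on the first `N₁` coordinates. -/
def firstProj {N N₁ : ℕ} (h : N₁ ≤ N) (σ : Euc N → Euc N) (x : Euc N) : Euc N₁ :=
  WithLp.toLp 2 fun j => σ x (Fin.castLE h j)

/-- `u ∈ BV^p(ℝ^N)`. -/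
structure MemBV {N : ℕ} (N₁ : ℕ) (p : Fin N → ℝ) (u : Euc N → ℝ) : Prop where
  memLp : MemLp u (ENNReal.ofReal (pStar N₁ p)) volume
  partial_measure : ∀ i : Fin N, (i : ℕ) < N₁ →
    ∃ s : SignedMeasure (Euc N), IsBoundedPartial i u s
  partial_memLp : ∀ i : Fin N, N₁ ≤ (i : ℕ) →
    ∃ d : Euc N → ℝ, MemLp d (ENNReal.ofReal (p i)) volume ∧ IsWeakPartial i u d

/-- `u ∈ BV^p_loc(ℝ^N)`: `φ u ∈ BV^p(ℝ^N)` for every test function `φ`. -/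
def MemBVLoc {N : ℕ} (N₁ : ℕ) (p : Fin N → ℝ) (u : Euc N → ℝ) : Prop :=
  ∀ φ : Test N, MemBV N₁ p fun x => φ x * u x

end

end AnisoBV

/-!
Let `σ_n` be the mollifications of `σ`. As `σ_n` is smooth, the Leibniz rule gives
`∑_i ⟨∂_i u, (σ_n)_i φ⟩ = -∫ (div σ_n) u φ - ∫ (σ_n · ∇φ) u`, where `div σ_n` is the mollification
of `div σ`. By Hölder's inequality both the right-hand side and the terms `∫ (σ_n)_i ∂_i u φ` of
the last coordinates converge, so the measures `σ_n^1 · ∇₁u` converge as distributions. Since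
`|σ_n^1|` is at most the essential supremum of `|σ^1|` over a slightly larger set, these measures
are bounded uniformly in terms of `|∇₁u|`; hence the limit `σ^1 · ∇₁u` is a Radon measure dominated
by `|∇₁u|`, and `σ · ∇u` is the sum of this measure and of a locally integrable function.

For the total mass, `σ · ∇u` is tested against the cutoff functions `φ_R(x) = b(R^{-α_i} x_i)` with
`α_i = 1 / p_i - 1 / p*`. The definition of `p*` says exactly that `∑_i α_i = 1`, which makes
`‖∂_i φ_R‖_{1 / α_i}` independent of `R`. Since `1 / p* + α_i + 1 / p_i' = 1`, Hölder's inequality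
bounds `∫ σ_i u ∂_i φ_R` by the norm of `u` in `L^{p*}` over the set where `∂_i φ_R ≠ 0`, up to a
constant, and this norm tends to `0` because `∇φ_R = 0` near any given point as `R → ∞`.
-/

namespace AnisoBV

open Filter Topology
open scoped Convolution

noncomputable section

/-! ### Hölder's inequality and mollification -/

section Hoelder

variable {X : Type*} [MeasurableSpace X] {μ : Measure X} {p q : ℝ≥0∞} [p.HolderConjugate q]
  {f g : X → ℝ}

theorem integral_norm_mul_le_eLpNorm (hf : MemLp f p μ) (hg : MemLp g q μ) :
    ∫ x, ‖f x * g x‖ ∂μ ≤ (eLpNorm f p μ).toReal * (eLpNorm g q μ).toReal := by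
  have h := eLpNorm_smul_le_mul_eLpNorm (p := p) (q := q) (r := 1) hg.1 hf.1
  rw [← ENNReal.toReal_mul,
    integral_norm_eq_lintegral_enorm (f := fun x => f x * g x) (hf.1.mul hg.1),
    ← eLpNorm_one_eq_lintegral_enorm]
  exact ENNReal.toReal_mono (ENNReal.mul_ne_top hf.2.ne hg.2.ne) h

theorem abs_integral_mul_le_eLpNorm (hf : MemLp f p μ) (hg : MemLp g q μ) :
    |∫ x, f x * g x ∂μ| ≤ (eLpNorm f p μ).toReal * (eLpNorm g q μ).toReal :=
  (norm_integral_le_integral_norm _).trans (integral_norm_mul_le_eLpNorm hf hg)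

end Hoelder

section Translation

variable {G : Type*} [AddCommGroup G] [TopologicalSpace G] [IsTopologicalAddGroup G] [R1Space G]
  [MeasurableSpace G] [BorelSpace G] {μ : Measure G} [μ.IsAddLeftInvariant] {p q : ℝ≥0∞}
  {v g : G → ℝ}

theorem continuous_integral_mul_translate [IsLocallyFiniteMeasure μ] [μ.InnerRegularCompactLTTop]
    [p.HolderConjugate q] (hp : p ≠ ∞) (hv : MemLp v p μ) (hg : MemLp g q μ) :
    Continuous fun s => ∫ x, v x * g (s + x) ∂μ := by
  have : Fact (1 ≤ p) := ⟨ENNReal.HolderConjugate.one_le p q⟩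
  have : Fact (1 ≤ q) := ⟨ENNReal.HolderConjugate.one_le q p⟩
  have : Fact (p ≠ ∞) := ⟨hp⟩
  have hpair : ∀ s, ∫ x, v x * g (s + x) ∂μ =
      (ContinuousLinearMap.mul ℝ ℝ).lpPairing μ p q (DomAddAct.mk (-s) +ᵥ hv.toLp v)
        (hg.toLp g) := by
    intro s
    rw [ContinuousLinearMap.lpPairing_eq_integral, DomAddAct.mk_vadd_toLp,
      ← integral_add_left_eq_self _ (-s)]
    refine integral_congr_ae ?_
    filter_upwards [MemLp.coeFn_toLp (hv.comp_measurePreserving (measurePreserving_vadd (-s) μ)),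
      hg.coeFn_toLp] with x hvx hgx
    refine Eq.trans ?_ (congrArg₂ (· * ·) hvx hgx).symm
    rw [add_neg_cancel_left]
    rfl
  simp only [hpair]
  have hs : Continuous fun s : G => DomAddAct.mk (-s) := DomAddAct.continuous_mk.comp continuous_neg
  exact (((ContinuousLinearMap.mul ℝ ℝ).lpPairing μ p q).flip (hg.toLp g)).continuous.comp
    (hs.vadd continuous_const)

end Translation

section Mollification

variable {N : ℕ} {F : Type*} [NormedAddCommGroup F] [NormedSpace ℝ F]

variable (N) in
/-- A bump function of radius `1 / (n + 1)` at the origin. -/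
def bump (n : ℕ) : ContDiffBump (0 : Euc N) where
  rIn := 1 / ((n : ℝ) + 1) / 2
  rOut := 1 / ((n : ℝ) + 1)
  rIn_pos := by positivity
  rIn_lt_rOut := half_lt_self (by positivity)

variable (N) in
/-- The mollifier supported in the ball of radius `1 / (n + 1)`. -/
def mollifier (n : ℕ) : Euc N → ℝ := (bump N n).normed volume

/-- The mollification of `f` at scale `1 / (n + 1)`. -/
def moll (n : ℕ) (f : Euc N → F) : Euc N → F :=
  mollifier N n ⋆[ContinuousLinearMap.lsmul ℝ ℝ, volume] f

theorem moll_apply (n : ℕ) (f : Euc N → F) (x : Euc N) :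
    moll n f x = ∫ t, mollifier N n t • f (x - t) := rfl

theorem contDiff_mollifier (n : ℕ) : ContDiff ℝ (⊤ : ℕ∞) (mollifier N n) :=
  (bump N n).contDiff_normed

theorem hasCompactSupport_mollifier (n : ℕ) : HasCompactSupport (mollifier N n) :=
  (bump N n).hasCompactSupport_normed

theorem mollifier_nonneg (n : ℕ) (x : Euc N) : 0 ≤ mollifier N n x :=
  (bump N n).nonneg_normed x

theorem mollifier_eq_zero {n : ℕ} {x : Euc N} (hx : 1 / ((n : ℝ) + 1) ≤ ‖x‖) :
    mollifier N n x = 0 := by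
  rw [← Function.notMem_support, mollifier, (bump N n).support_normed_eq, mem_ball_zero_iff]
  exact hx.not_gt

theorem integral_mollifier (n : ℕ) : ∫ x, mollifier N n x = 1 :=
  (bump N n).integral_normed

theorem integrable_mollifier (n : ℕ) : Integrable (mollifier N n) :=
  (bump N n).integrable_normed

theorem integrable_mollifier_smul {f : Euc N → F} (hf : LocallyIntegrable f) (n : ℕ)
    (x : Euc N) : Integrable fun t => mollifier N n t • f (x - t) :=
  (hasCompactSupport_mollifier n).convolutionExists_left (ContinuousLinearMap.lsmul ℝ ℝ)
    (contDiff_mollifier n).continuous hf x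

theorem contDiff_moll {f : Euc N → F} (hf : LocallyIntegrable f) (n : ℕ) :
    ContDiff ℝ (⊤ : ℕ∞) (moll n f) :=
  (hasCompactSupport_mollifier n).contDiff_convolution_left _ (contDiff_mollifier n) hf

theorem moll_congr {f g : Euc N → F} {n : ℕ} {x : Euc N}
    (h : ∀ y ∈ Metric.ball x (1 / ((n : ℝ) + 1)), f y = g y) : moll n f x = moll n g x := by
  simp only [moll_apply]
  congr 1 with t
  rcases lt_or_ge ‖t‖ (1 / ((n : ℝ) + 1)) with ht | ht
  · rw [h (x - t) (by simpa using ht)]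
  · simp only [mollifier_eq_zero ht, zero_smul]

theorem norm_moll_le {f : Euc N → F} {M : ℝ} {n : ℕ} {x : Euc N}
    (h : ∀ᵐ y, y ∈ Metric.ball x (1 / ((n : ℝ) + 1)) → ‖f y‖ ≤ M) : ‖moll n f x‖ ≤ M := by
  have hM : ∀ᵐ t, ‖mollifier N n t • f (x - t)‖ ≤ mollifier N n t * M := by
    filter_upwards [(Measure.measurePreserving_sub_left volume x).quasiMeasurePreserving.ae h]
      with t ht
    rw [norm_smul, Real.norm_of_nonneg (mollifier_nonneg n t)]
    rcases lt_or_ge ‖t‖ (1 / ((n : ℝ) + 1)) with hlt | hge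
    · exact mul_le_mul_of_nonneg_left (ht (by simpa using hlt)) (mollifier_nonneg n t)
    · simp only [mollifier_eq_zero hge, zero_mul, le_refl]
  have hle := norm_integral_le_of_norm_le ((integrable_mollifier n).mul_const M) hM
  rwa [integral_mul_const, integral_mollifier, one_mul] at hle

theorem moll_proj {m : ℕ} {τ : Euc N → Euc m} (hτ : LocallyIntegrable τ) (n : ℕ)
    (x : Euc N) (j : Fin m) : moll n τ x j = moll n (fun y => τ y j) x := by
  have h := (EuclideanSpace.proj (𝕜 := ℝ) (ι := Fin m) j).integral_comp_comm
    (integrable_mollifier_smul hτ n x)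
  simpa [moll_apply] using h.symm

theorem tendsto_moll_of_continuous {f : Euc N → F} [CompleteSpace F] (hf : Continuous f)
    (x : Euc N) : Tendsto (fun n => moll n f x) atTop (𝓝 (f x)) :=
  ContDiffBump.convolution_tendsto_right_of_continuous (φ := bump N)
    tendsto_one_div_add_atTop_nhds_zero_nat hf x

theorem tendstoUniformly_moll {f : Euc N → F} [CompleteSpace F] (hf : UniformContinuous f) :
    TendstoUniformly (fun n => moll n f) f atTop := by
  refine Metric.tendstoUniformly_iff.2 fun ε hε => ?_
  obtain ⟨δ, hδ, h⟩ := Metric.uniformContinuous_iff.1 hf (ε / 2) (half_pos hε)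
  filter_upwards [tendsto_one_div_add_atTop_nhds_zero_nat.eventually_lt_const hδ] with n hn x
  rw [dist_comm]
  exact (ContDiffBump.dist_normed_convolution_le hf.continuous.aestronglyMeasurable
    fun y hy => (h (hy.trans hn)).le).trans_lt (half_lt_self hε)

theorem ball_one_div_subset_cthickening_one {s : Set (Euc N)} {x : Euc N} (hx : x ∈ s) (n : ℕ) :
    Metric.ball x (1 / ((n : ℝ) + 1)) ⊆ Metric.cthickening 1 s := fun y hy =>
  Metric.mem_cthickening_of_dist_le y x _ _ hx ((Metric.mem_ball.1 hy).le.trans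
    (div_le_one_of_le₀ (by linarith [n.cast_nonneg (α := ℝ)]) (by positivity)))

variable {p q : ℝ≥0∞} [p.HolderConjugate q] {v g : Euc N → ℝ}

theorem integrable_mollifier_mul_mul (hv : MemLp v p) (hg : MemLp g q) (n : ℕ) :
    Integrable (fun z : Euc N × Euc N => mollifier N n z.2 * g (z.1 - z.2) * v z.1)
      (volume.prod volume) := by
  have hm : AEStronglyMeasurable
      (fun z : Euc N × Euc N => mollifier N n z.2 * g (z.1 - z.2) * v z.1)
      (volume.prod volume) :=
    ((contDiff_mollifier n).continuous.aestronglyMeasurable.convolution_integrand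
      (ContinuousLinearMap.lsmul ℝ ℝ) hg.1).mul hv.1.comp_fst
  have hgt : ∀ t, MemLp (fun x => g (x - t)) q := fun t =>
    hg.comp_measurePreserving (measurePreserving_sub_right volume t)
  have hnorm : ∀ t, ∫ x, ‖v x * g (x - t)‖ ≤ (eLpNorm v p).toReal * (eLpNorm g q).toReal := by
    intro t
    rw [← eLpNorm_comp_measurePreserving hg.1 (measurePreserving_sub_right volume t)]
    exact integral_norm_mul_le_eLpNorm hv (hgt t)
  refine (integrable_prod_iff' hm).2 ⟨.of_forall fun t => ?_, ?_⟩
  · refine ((hv.integrable_mul (hgt t)).const_mul (mollifier N n t)).congr (.of_forall fun x => ?_)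
    simp only [Pi.mul_apply]
    ring
  · refine ((integrable_mollifier n).mul_const
      ((eLpNorm v p).toReal * (eLpNorm g q).toReal)).mono'
      hm.norm.prod_swap.integral_prod_right' (.of_forall fun t => ?_)
    have h := mul_le_mul_of_nonneg_left (hnorm t) (mollifier_nonneg n t)
    rw [Real.norm_of_nonneg (integral_nonneg fun _ => norm_nonneg _)]
    simpa only [mul_assoc, norm_mul, Real.norm_of_nonneg (mollifier_nonneg n t),
      integral_const_mul, mul_comm ‖v _‖] using h

theorem integral_moll_mul (hv : MemLp v p) (hg : MemLp g q) (n : ℕ) :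
    ∫ x, moll n g x * v x = moll n (fun s => ∫ x, v x * g (s + x)) 0 := by
  calc ∫ x, moll n g x * v x = ∫ x, ∫ t, mollifier N n t * g (x - t) * v x := by
        simp only [moll_apply, smul_eq_mul, integral_mul_const]
    _ = ∫ t, ∫ x, mollifier N n t * g (x - t) * v x :=
        integral_integral_swap (integrable_mollifier_mul_mul hv hg n)
    _ = moll n (fun s => ∫ x, v x * g (s + x)) 0 := by
        simp only [moll_apply, smul_eq_mul, ← integral_const_mul]
        congr! 4 with t
        rw [zero_sub, neg_add_eq_sub]
        ring

theorem tendsto_integral_moll_mul_of_memLp (hp : p ≠ ∞) (hv : MemLp v p) (hg : MemLp g q) :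
    Tendsto (fun n => ∫ x, moll n g x * v x) atTop (𝓝 (∫ x, g x * v x)) := by
  simp only [integral_moll_mul hv hg]
  simpa only [zero_add, mul_comm (v _)] using
    tendsto_moll_of_continuous (continuous_integral_mul_translate hp hv hg) 0

end Mollification

section LocalSpaces

variable {N : ℕ} {F : Type*} [NormedAddCommGroup F] {p q : ℝ≥0∞}

theorem MemLpLoc.mono_exponent {f : Euc N → F} (hpq : p ≤ q) (hf : MemLpLoc f q) :
    MemLpLoc f p := by
  intro K hK
  have := isFiniteMeasure_restrict.2 (hK.measure_ne_top (μ := volume))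
  exact (hf K hK).mono_exponent hpq

theorem memLpLoc_one_iff {f : Euc N → F} : MemLpLoc f 1 ↔ LocallyIntegrable f := by
  rw [locallyIntegrable_iff]
  exact forall₂_congr fun _ _ => memLp_one_iff_integrable

theorem MemLpLoc.locallyIntegrable {f : Euc N → F} (hq : 1 ≤ q) (hf : MemLpLoc f q) :
    LocallyIntegrable f :=
  memLpLoc_one_iff.1 (hf.mono_exponent hq)

theorem MemLpLoc.locallyIntegrable_mul {f g : Euc N → ℝ} [p.HolderConjugate q]
    (hf : MemLpLoc f p) (hg : MemLpLoc g q) : LocallyIntegrable fun x => f x * g x :=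
  locallyIntegrable_iff.2 fun K hK => (hf K hK).integrable_mul (hg K hK)

theorem MemLpLoc.mul_of_hasCompactSupport {f v : Euc N → ℝ} (hf : MemLpLoc f q)
    (hv : Continuous v) (hvc : HasCompactSupport v) : MemLp (fun x => f x * v x) q := by
  have hmem : MemLp (fun x => f x * v x) q (volume.restrict (tsupport v)) :=
    (hv.memLp_top_of_hasCompactSupport hvc _).mul (hf _ hvc)
  rw [← memLp_indicator_iff_restrict (isClosed_tsupport v).measurableSet] at hmem
  rwa [indicator_eq_self.2 ((Function.support_mul_subset_right f v).trans (subset_tsupport v))]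
    at hmem

theorem tendsto_integral_moll_mul [p.HolderConjugate q] (hp : p ≠ ∞) {v g : Euc N → ℝ}
    (hv : MemLp v p) (hvc : HasCompactSupport v) (hg : MemLpLoc g q) :
    Tendsto (fun n => ∫ x, moll n g x * v x) atTop (𝓝 (∫ x, g x * v x)) := by
  set K := Metric.cthickening 1 (tsupport v)
  have hK : IsCompact K := hvc.isCompact.cthickening
  have h := tendsto_integral_moll_mul_of_memLp hp hv
    ((memLp_indicator_iff_restrict hK.measurableSet).2 (hg K hK))
  have congr_tsupport : ∀ {f₁ f₂ : Euc N → ℝ}, (∀ x ∈ tsupport v, f₁ x = f₂ x) →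
      ∫ x, f₁ x * v x = ∫ x, f₂ x * v x := by
    intro f₁ f₂ hf
    congr with x
    by_cases hx : x ∈ tsupport v
    · rw [hf x hx]
    · rw [image_eq_zero_of_notMem_tsupport hx, mul_zero, mul_zero]
  convert! h using 1
  · funext n
    exact congr_tsupport fun x hx =>
      moll_congr fun y hy =>
        (indicator_of_mem (ball_one_div_subset_cthickening_one hx n hy) g).symm
  · exact congrArg 𝓝 (congr_tsupport fun x hx =>
      (indicator_of_mem (Metric.self_subset_cthickening _ hx) g).symm)

end LocalSpaces

/-! ### Radon measures as limits of linear forms -/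

section LocallyBounded

variable {X V : Type*} [TopologicalSpace X] [AddCommGroup V] [Module ℝ V]
  {ev : V →ₗ[ℝ] X → ℝ} {L : V →ₗ[ℝ] ℝ} {K : Set X} {C : ℝ}

theorem abs_map_le_mul (hL : ∀ φ, tsupport (ev φ) ⊆ K → (∀ x, |ev φ x| ≤ 1) → |L φ| ≤ C)
    {φ : V} {ε : ℝ} (hε : 0 < ε) (hφK : tsupport (ev φ) ⊆ K) (hφ : ∀ x, |ev φ x| ≤ ε) :
    |L φ| ≤ C * ε := by
  have h := hL (ε⁻¹ • φ)
    ((closure_mono (by simpa only [map_smul] using Function.support_const_smul_subset _ _)).trans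
      hφK)
    fun x => by
      rw [map_smul, Pi.smul_apply, smul_eq_mul, abs_mul, abs_of_pos (inv_pos.2 hε),
        inv_mul_le_iff₀ hε, mul_one]
      exact hφ x
  rwa [map_smul, smul_eq_mul, abs_mul, abs_of_pos (inv_pos.2 hε), inv_mul_le_iff₀ hε,
    mul_comm] at h

theorem tendsto_map_of_tendstoUniformly
    (hL : ∀ φ, tsupport (ev φ) ⊆ K → (∀ x, |ev φ x| ≤ 1) → |L φ| ≤ C)
    {φ : ℕ → V} {φ₀ : V} (hφ : ∀ n, tsupport (ev (φ n)) ⊆ K) (hφ₀ : tsupport (ev φ₀) ⊆ K)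
    (hlim : TendstoUniformly (fun n => ev (φ n)) (ev φ₀) atTop) :
    Tendsto (fun n => L (φ n)) atTop (𝓝 (L φ₀)) := by
  refine Metric.tendsto_atTop'.2 fun ε hε => ?_
  have hC : 0 < |C| + 1 := by positivity
  obtain ⟨n₀, hn₀⟩ := eventually_atTop.1
    (Metric.tendstoUniformly_iff.1 hlim (ε / (|C| + 1)) (div_pos hε hC))
  refine ⟨n₀, fun n hn => ?_⟩
  have h : |L (φ n - φ₀)| ≤ C * (ε / (|C| + 1)) := by
    refine abs_map_le_mul hL (div_pos hε hC) ?_ fun x => ?_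
    · rw [map_sub]
      exact (tsupport_sub _ _).trans (union_subset (hφ n) hφ₀)
    · have hx := (hn₀ n hn.le x).le
      rwa [dist_comm, Real.dist_eq, ← Pi.sub_apply, ← map_sub] at hx
  rw [Real.dist_eq, ← map_sub]
  calc |L (φ n - φ₀)| ≤ C * (ε / (|C| + 1)) := h
    _ < (|C| + 1) * (ε / (|C| + 1)) :=
        mul_lt_mul_of_pos_right ((le_abs_self C).trans_lt (lt_add_one _)) (div_pos hε hC)
    _ = ε := mul_div_cancel₀ _ hC.ne'

end LocallyBounded

section RadonMeasure

variable {X : Type*} [TopologicalSpace X]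

/-- The functions underlying the elements of `C_c(X)`. -/
def ccEval : C_c(X, ℝ) →ₗ[ℝ] X → ℝ where
  toFun φ := φ
  map_add' _ _ := rfl
  map_smul' _ _ := rfl

theorem abs_toLin_le_mul {A : C_c(X, ℝ) →ₗ[ℝ] ℝ} {K : Set X} {C : ℝ}
    (hA : ∀ φ : C_c(X, ℝ), tsupport φ ⊆ K → (∀ x, |φ x| ≤ 1) → |A φ| ≤ C)
    {φ : C_c(X, ℝ)} {ε : ℝ} (hε : 0 < ε) (hφK : tsupport φ ⊆ K) (hφ : ∀ x, |φ x| ≤ ε) :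
    |A φ| ≤ C * ε :=
  abs_map_le_mul (ev := ccEval) hA hε hφK hφ

theorem RadonMeasure.tendsto_toLin (μ : RadonMeasure X) {K : Set X} (hK : IsCompact K)
    {φ : ℕ → C_c(X, ℝ)} {φ₀ : C_c(X, ℝ)} (hφ : ∀ n, tsupport (φ n) ⊆ K) (hφ₀ : tsupport φ₀ ⊆ K)
    (hlim : TendstoUniformly (fun n x => φ n x) φ₀ atTop) :
    Tendsto (fun n => μ.toLin (φ n)) atTop (𝓝 (μ.toLin φ₀)) :=
  let ⟨_, hC⟩ := μ.bound K hK
  tendsto_map_of_tendstoUniformly (ev := ccEval) hC hφ hφ₀ hlim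

end RadonMeasure

section Regularization

variable {N : ℕ}

/-- The functions underlying the test functions. -/
def testEval : Test N →ₗ[ℝ] Euc N → ℝ where
  toFun φ := φ
  map_add' _ _ := rfl
  map_smul' _ _ := rfl

/-- A smooth compactly supported function as a test function. -/
def mkTest (f : Euc N → ℝ) (h : ContDiff ℝ (⊤ : ℕ∞) f) (hc : HasCompactSupport f) : Test N :=
  ⟨f, h, hc, fun _ _ => trivial⟩

@[simp]
theorem mkTest_apply (f : Euc N → ℝ) (h : ContDiff ℝ (⊤ : ℕ∞) f) (hc : HasCompactSupport f)
    (x : Euc N) : mkTest f h hc x = f x := rfl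

theorem tsupport_moll_subset (f : Euc N → ℝ) (n : ℕ) :
    tsupport (moll n f) ⊆ Metric.cthickening 1 (tsupport f) := by
  refine closure_minimal (fun x hx => ?_) Metric.isClosed_cthickening
  by_contra h
  refine hx ((moll_congr (g := 0) fun y hy => ?_).trans (by simp [moll_apply]))
  refine image_eq_zero_of_notMem_tsupport fun hy' => h ?_
  exact ball_one_div_subset_cthickening_one hy' n (Metric.mem_ball_comm.1 hy)

theorem hasCompactSupport_moll {f : Euc N → ℝ} (hf : HasCompactSupport f) (n : ℕ) :
    HasCompactSupport (moll n f) :=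
  hf.isCompact.cthickening.of_isClosed_subset (isClosed_tsupport _) (tsupport_moll_subset f n)

theorem moll_add {f g : Euc N → ℝ} (hf : LocallyIntegrable f) (hg : LocallyIntegrable g)
    (n : ℕ) : moll n (f + g) = moll n f + moll n g := by
  funext x
  simp only [Pi.add_apply, moll_apply, smul_add]
  exact integral_add (integrable_mollifier_smul hf n x) (integrable_mollifier_smul hg n x)

/-- Mollification at scale `1 / (n + 1)`, from `C_c` to test functions. -/
def mollTest (n : ℕ) : C_c(Euc N, ℝ) →ₗ[ℝ] Test N where
  toFun φ := mkTest (moll n φ) (contDiff_moll φ.continuous.locallyIntegrable n)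
    (hasCompactSupport_moll φ.hasCompactSupport n)
  map_add' φ ψ := DFunLike.coe_injective
    (moll_add φ.continuous.locallyIntegrable ψ.continuous.locallyIntegrable n)
  map_smul' _ _ := DFunLike.coe_injective (convolution_smul)

theorem tsupport_mollTest_subset (n : ℕ) (φ : C_c(Euc N, ℝ)) :
    tsupport (mollTest n φ) ⊆ Metric.cthickening 1 (tsupport φ) :=
  tsupport_moll_subset φ n

theorem abs_mollTest_le {φ : C_c(Euc N, ℝ)} {C : ℝ} (hφ : ∀ x, |φ x| ≤ C) (n : ℕ) (x : Euc N) :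
    |mollTest n φ x| ≤ C :=
  norm_moll_le (f := φ) (n := n) (x := x) (.of_forall fun y _ => hφ y)

theorem tendstoUniformly_mollTest (φ : C_c(Euc N, ℝ)) :
    TendstoUniformly (fun n => ⇑(mollTest n φ)) φ atTop :=
  tendstoUniformly_moll (φ.hasCompactSupport.uniformContinuous_of_continuous φ.continuous)

theorem RadonMeasure.tendsto_toLin_mollTest (μ : RadonMeasure (Euc N)) (φ : C_c(Euc N, ℝ)) :
    Tendsto (fun n => μ.toLin (mollTest n φ).toCc) atTop (𝓝 (μ.toLin φ)) :=
  μ.tendsto_toLin φ.hasCompactSupport.isCompact.cthickening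
    (fun n => tsupport_mollTest_subset n φ) (Metric.self_subset_cthickening _)
    (tendstoUniformly_mollTest φ)

theorem exists_radonMeasure_of_tendsto {A : ℕ → C_c(Euc N, ℝ) →ₗ[ℝ] ℝ}
    (hA : ∀ K : Set (Euc N), IsCompact K → ∃ C : ℝ, ∀ n, ∀ φ : C_c(Euc N, ℝ),
      tsupport φ ⊆ K → (∀ x, |φ x| ≤ 1) → |A n φ| ≤ C)
    (hlim : ∀ ψ : Test N, ∃ l, Tendsto (fun n => A n ψ.toCc) atTop (𝓝 l)) :
    ∃ S : RadonMeasure (Euc N), ∀ φ, Tendsto (fun n => A n φ) atTop (𝓝 (S.toLin φ)) := by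
  have hcauchy : ∀ φ, CauchySeq fun n => A n φ := by
    intro φ
    obtain ⟨C, hC⟩ := hA _ (φ.hasCompactSupport.isCompact.cthickening (r := 1))
    refine Metric.cauchySeq_iff'.2 fun ε hε => ?_
    have hδ : 0 < ε / (3 * (|C| + 1)) := by positivity
    obtain ⟨k, hk⟩ := (Metric.tendstoUniformly_iff.1 (tendstoUniformly_mollTest φ) _ hδ).exists
    have happrox : ∀ n, |A n φ - A n (mollTest k φ).toCc| < ε / 3 := by
      intro n
      rw [← map_sub]
      refine (abs_toLin_le_mul (hC n) hδ ?_ fun x => (hk x).le).trans_lt ?_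
      · exact (tsupport_sub _ _).trans
          (union_subset (Metric.self_subset_cthickening _) (tsupport_mollTest_subset k φ))
      · rw [← div_div, mul_div_assoc', div_lt_iff₀ (by positivity), mul_comm]
        exact mul_lt_mul_of_pos_left ((le_abs_self C).trans_lt (lt_add_one _)) (by positivity)
    obtain ⟨l, hl⟩ := hlim (mollTest k φ)
    obtain ⟨n₀, hn₀⟩ := Metric.cauchySeq_iff'.1 hl.cauchySeq (ε / 3) (by positivity)
    refine ⟨n₀, fun n hn => ?_⟩
    have h₁ := abs_lt.1 (happrox n)
    have h₂ := abs_lt.1 (hn₀ n hn)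
    have h₃ := abs_lt.1 (happrox n₀)
    rw [Real.dist_eq, abs_lt]
    constructor <;> linarith
  choose f hf using fun φ => cauchySeq_tendsto_of_complete (hcauchy φ)
  refine ⟨⟨linearMapOfTendsto f A (tendsto_pi_nhds.2 hf), fun K hK => ?_⟩, hf⟩
  obtain ⟨C, hC⟩ := hA K hK
  exact ⟨C, fun φ hφK hφ => le_of_tendsto (hf φ).abs (.of_forall fun n => hC n φ hφK hφ)⟩

theorem exists_radonMeasure_eq {L : Test N →ₗ[ℝ] ℝ}
    (hL : ∀ K : Set (Euc N), IsCompact K → ∃ C : ℝ, ∀ φ : Test N,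
      tsupport φ ⊆ K → (∀ x, |φ x| ≤ 1) → |L φ| ≤ C) :
    ∃ S : RadonMeasure (Euc N), ∀ φ : Test N, S.toLin φ.toCc = L φ := by
  have hlim : ∀ ψ : Test N, Tendsto (fun n => L (mollTest n ψ.toCc)) atTop (𝓝 (L ψ)) := by
    intro ψ
    obtain ⟨C, hC⟩ := hL _ (ψ.toCc.hasCompactSupport.isCompact.cthickening (r := 1))
    exact tendsto_map_of_tendstoUniformly (ev := testEval) hC
      (fun n => tsupport_mollTest_subset n _) (Metric.self_subset_cthickening _)
      (tendstoUniformly_mollTest _)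
  obtain ⟨S, hS⟩ := exists_radonMeasure_of_tendsto (A := fun n => L ∘ₗ mollTest n)
    (fun K hK => by
      obtain ⟨C, hC⟩ := hL _ (hK.cthickening (r := 1))
      exact ⟨C, fun n φ hφK hφ => hC _ ((tsupport_mollTest_subset n φ).trans
        (Metric.cthickening_subset_of_subset 1 hφK)) (abs_mollTest_le hφ n)⟩)
    fun ψ => ⟨_, hlim ψ⟩
  exact ⟨S, fun ψ => tendsto_nhds_unique (hS ψ.toCc) (hlim ψ)⟩

end Regularization

/-! ### Total variation -/

section TotalVariation

variable {X : Type*} [TopologicalSpace X] {ι : Type*} [Fintype ι]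

/-- The absolute value of a function of `C_c(X)`. -/
def absCc (φ : C_c(X, ℝ)) : C_c(X, ℝ≥0) := φ.compLeft ⟨nnnorm, continuous_nnnorm⟩

@[simp]
theorem absCc_apply (φ : C_c(X, ℝ)) (x : X) : (absCc φ x : ℝ) = |φ x| := by
  rw [absCc, CompactlySupportedContinuousMap.compLeft_apply (by simp)]
  simp

theorem tsupport_absCc (φ : C_c(X, ℝ)) : tsupport (absCc φ) = tsupport φ := by
  refine congrArg closure (Set.ext fun x => not_congr ?_)
  rw [← NNReal.coe_inj, absCc_apply, NNReal.coe_zero, abs_eq_zero]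

theorem abs_sum_le_tvSup (μ : ι → RadonMeasure X) (φ : C_c(X, ℝ≥0)) (ψ : ι → C_c(X, ℝ))
    (hψ : ∀ x, ∑ i, ψ i x ^ 2 ≤ (φ x : ℝ) ^ 2) : |∑ i, (μ i).toLin (ψ i)| ≤ tvSup μ φ :=
  abs_le'.2 ⟨le_csSup (bddAbove_tvSet _ _) ⟨ψ, hψ, rfl⟩,
    le_csSup (bddAbove_tvSet _ _) ⟨fun i => -ψ i, by simpa using hψ, by simp⟩⟩

theorem tvSup_mono (μ : ι → RadonMeasure X) {φ ψ : C_c(X, ℝ≥0)} (h : ∀ x, φ x ≤ ψ x) :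
    tvSup μ φ ≤ tvSup μ ψ := by
  refine csSup_le ⟨0, zero_mem_tvSet μ _⟩ ?_
  rintro _ ⟨χ, hχ, rfl⟩
  refine (le_abs_self _).trans (abs_sum_le_tvSup μ ψ χ fun x => (hχ x).trans ?_)
  have hx : (φ x : ℝ) ≤ ψ x := h x
  gcongr

theorem abs_apply_le_of_sum_sq_le {φ : C_c(X, ℝ≥0)} {ψ : ι → C_c(X, ℝ)} {x : X}
    (hψ : ∑ i, ψ i x ^ 2 ≤ (φ x : ℝ) ^ 2) (i : ι) : |ψ i x| ≤ φ x :=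
  abs_le_of_sq_le_sq ((Finset.single_le_sum (fun j _ => sq_nonneg (ψ j x))
    (Finset.mem_univ i)).trans hψ) (φ x).coe_nonneg

theorem tvSup_le_sum {μ : ι → RadonMeasure X} {φ : C_c(X, ℝ≥0)} {B : ι → ℝ}
    (hB : ∀ i, ∀ ψ : C_c(X, ℝ), (∀ x, |ψ x| ≤ φ x) → |(μ i).toLin ψ| ≤ B i) :
    tvSup μ φ ≤ ∑ i, B i := by
  refine csSup_le ⟨0, zero_mem_tvSet _ _⟩ ?_
  rintro _ ⟨χ, hχ, rfl⟩
  exact Finset.sum_le_sum fun i _ =>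
    (le_abs_self _).trans (hB i _ fun x => abs_apply_le_of_sum_sq_le (hχ x) _)

theorem exists_tvSup_le_of_tsupport_subset (μ : ι → RadonMeasure X) {K : Set X}
    (hK : IsCompact K) :
    ∃ C : ℝ, ∀ φ : C_c(X, ℝ≥0), tsupport φ ⊆ K → (∀ x, φ x ≤ 1) → tvSup μ φ ≤ C := by
  choose C hC using fun i => (μ i).bound K hK
  refine ⟨∑ i, C i, fun φ hφK hφ => tvSup_le_sum fun i ψ hψ => hC i ψ ?_ fun x =>
    (hψ x).trans (NNReal.coe_le_coe.2 (hφ x))⟩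
  refine (closure_mono (Function.support_subset_iff'.2 fun x hx => ?_)).trans hφK
  simpa [Function.notMem_support.1 hx] using hψ x

theorem abs_toLin_toReal_le (S : RadonMeasure X) (φ : C_c(X, ℝ≥0)) :
    |S.toLin φ.toReal| ≤ tvSup (fun _ : Unit => S) φ := by
  simpa using abs_sum_le_tvSup (fun _ : Unit => S) φ (fun _ => φ.toReal) (by simp)

end TotalVariation

section MeasureComparison

variable {X : Type*} [TopologicalSpace X]

theorem measure_le_lintegral_of_eq_one [T2Space X] [MeasurableSpace X] [BorelSpace X]
    (μ : Measure X) {K : Set X} (hK : IsCompact K) {φ : C_c(X, ℝ≥0)}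
    (hφ : ∀ x ∈ K, φ x = 1) : μ K ≤ ∫⁻ x, φ x ∂μ := by
  rw [← lintegral_indicator_one hK.measurableSet]
  refine lintegral_mono (indicator_le fun x hx => ?_)
  simp [hφ x hx]

variable [T2Space X] [LocallyCompactSpace X]

theorem exists_cc_eq_one_of_isCompact {K V : Set X} (hK : IsCompact K) (hV : IsOpen V)
    (hKV : K ⊆ V) :
    ∃ φ : C_c(X, ℝ≥0), (∀ x ∈ K, φ x = 1) ∧ tsupport φ ⊆ V ∧ ∀ x, φ x ≤ 1 := by
  obtain ⟨f, hf_one, hf_supp, hfV, hf_mem⟩ :=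
    exists_continuousMap_one_of_isCompact_subset_isOpen hK hV hKV
  have hφ : ∀ x, (absCc ⟨f, hf_supp⟩ x : ℝ) = f x := fun x =>
    (absCc_apply _ x).trans (abs_of_nonneg (hf_mem x).1)
  refine ⟨absCc ⟨f, hf_supp⟩, fun x hx => NNReal.eq ((hφ x).trans (hf_one hx)),
    (closure_mono fun x hx hfx => ?_).trans hfV,
    fun x => NNReal.coe_le_coe.1 ((hφ x).trans_le (hf_mem x).2)⟩
  exact hx (NNReal.eq ((hφ x).trans hfx))

variable [MeasurableSpace X] [BorelSpace X]

theorem measure_isCompact_le_of_lintegral_le {μ ν : Measure X} [ν.OuterRegular] {W : Set X}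
    (hW : IsOpen W) (h : ∀ φ : C_c(X, ℝ≥0), tsupport φ ⊆ W → ∫⁻ x, φ x ∂μ ≤ ∫⁻ x, φ x ∂ν)
    {K : Set X} (hK : IsCompact K) (hKW : K ⊆ W) : μ K ≤ ν K := by
  rw [K.measure_eq_iInf_isOpen ν]
  refine le_iInf₂ fun V hKV => le_iInf fun hV => ?_
  obtain ⟨φ, hφ_one, hφ_supp, hφ_le⟩ :=
    exists_cc_eq_one_of_isCompact hK (hV.inter hW) (subset_inter hKV hKW)
  calc μ K ≤ ∫⁻ x, φ x ∂μ := measure_le_lintegral_of_eq_one μ hK hφ_one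
    _ ≤ ∫⁻ x, φ x ∂ν := h φ (hφ_supp.trans inter_subset_right)
    _ ≤ ∫⁻ x, V.indicator 1 x ∂ν := by
      refine lintegral_mono fun x => ?_
      by_cases hx : x ∈ V
      · simpa [hx] using hφ_le x
      · simp [image_eq_zero_of_notMem_tsupport fun hx' => hx (hφ_supp hx').1]
    _ = ν V := lintegral_indicator_one hV.measurableSet

theorem restrict_le_restrict_of_lintegral_le {μ ν : Measure X} [μ.InnerRegular] [ν.OuterRegular]
    {W : Set X} (hW : IsOpen W)
    (h : ∀ φ : C_c(X, ℝ≥0), tsupport φ ⊆ W → ∫⁻ x, φ x ∂μ ≤ ∫⁻ x, φ x ∂ν) :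
    μ.restrict W ≤ ν.restrict W := by
  refine Measure.le_iff.2 fun A hA => ?_
  rw [Measure.restrict_apply hA, Measure.restrict_apply hA,
    (hA.inter hW.measurableSet).measure_eq_iSup_isCompact]
  refine iSup₂_le fun K hKA => iSup_le fun hK => ?_
  exact (measure_isCompact_le_of_lintegral_le hW h hK (hKA.trans inter_subset_right)).trans
    (measure_mono hKA)

end MeasureComparison

/-! ### Bounded Radon measures -/

section SignedIntegral

variable {X : Type*} [MeasurableSpace X]

theorem abs_signedIntegral_le (s : SignedMeasure X) {f : X → ℝ} {C : ℝ} (hC : ∀ x, |f x| ≤ C) :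
    |signedIntegral s f| ≤ C * s.totalVariation.real univ := by
  have hbound : ∀ μ : Measure X, [IsFiniteMeasure μ] → |∫ x, f x ∂μ| ≤ C * μ.real univ :=
    fun μ _ => norm_integral_le_of_norm_le_const (f := f) (.of_forall hC)
  rw [signedIntegral, SignedMeasure.totalVariation, measureReal_add_apply, mul_add]
  exact (abs_sub _ _).trans (add_le_add (hbound _) (hbound _))

theorem signedIntegral_one (s : SignedMeasure X) : signedIntegral s (fun _ => 1) = s univ := by
  simp [signedIntegral, s.apply_eq_posPart_real_sub_negPart_real MeasurableSet.univ]

theorem tendsto_signedIntegral (s : SignedMeasure X) {f : ℕ → X → ℝ} {f₀ : X → ℝ} {C : ℝ}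
    (hf : ∀ n, Measurable (f n)) (hC : ∀ n x, |f n x| ≤ C)
    (hlim : ∀ x, Tendsto (fun n => f n x) atTop (𝓝 (f₀ x))) :
    Tendsto (fun n => signedIntegral s (f n)) atTop (𝓝 (signedIntegral s f₀)) := by
  have hdom : ∀ μ : Measure X, [IsFiniteMeasure μ] →
      Tendsto (fun n => ∫ x, f n x ∂μ) atTop (𝓝 (∫ x, f₀ x ∂μ)) := fun μ _ =>
    tendsto_integral_of_dominated_convergence (fun _ => C)
      (fun n => (hf n).aestronglyMeasurable) (integrable_const C)
      (fun n => .of_forall (hC n)) (.of_forall hlim)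
  exact (hdom _).sub (hdom _)

theorem signedIntegral_sub_toSignedMeasure [TopologicalSpace X] [OpensMeasurableSpace X]
    (μ ν : Measure X) [IsFiniteMeasure μ] [IsFiniteMeasure ν] (φ : C_c(X, ℝ)) :
    signedIntegral (μ.toSignedMeasure - ν.toSignedMeasure) φ = ∫ x, φ x ∂μ - ∫ x, φ x ∂ν := by
  set s := μ.toSignedMeasure - ν.toSignedMeasure with hs
  have hmeasure : s.toJordanDecomposition.posPart + ν = μ + s.toJordanDecomposition.negPart := by
    have hjordan : s.toJordanDecomposition.posPart.toSignedMeasure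
        - s.toJordanDecomposition.negPart.toSignedMeasure = s :=
      s.toSignedMeasure_toJordanDecomposition
    rw [hs, sub_eq_sub_iff_add_eq_add] at hjordan
    rwa [← Measure.toSignedMeasure_eq_toSignedMeasure_iff, Measure.toSignedMeasure_add,
      Measure.toSignedMeasure_add]
  have hintegral := congrArg (fun m : Measure X => ∫ x, φ x ∂m) hmeasure
  simp only [integral_add_measure φ.integrable φ.integrable] at hintegral
  rw [signedIntegral, sub_eq_sub_iff_add_eq_add, hintegral]

end SignedIntegral

section Bounded

variable {X : Type*} [TopologicalSpace X]

/-- `μ` is continuous for the uniform norm, which by the Riesz theorem means that it is given by a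
finite signed measure. -/
def RadonMeasure.IsBounded (μ : RadonMeasure X) : Prop :=
  ∃ C : ℝ, ∀ φ : C_c(X, ℝ), (∀ x, |φ x| ≤ 1) → |μ.toLin φ| ≤ C

theorem RadonMeasure.IsBoundedMeasure.isBounded [MeasurableSpace X] {μ : RadonMeasure X}
    {s : SignedMeasure X} (h : μ.IsBoundedMeasure s) : μ.IsBounded :=
  ⟨_, fun φ hφ => by rw [h φ]; exact abs_signedIntegral_le s hφ⟩

theorem RadonMeasure.IsBounded.exists_tvSup_le {ι : Type*} [Fintype ι] {D : ι → RadonMeasure X}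
    (hD : ∀ i, (D i).IsBounded) :
    ∃ C : ℝ, ∀ φ : C_c(X, ℝ≥0), (∀ x, φ x ≤ 1) → tvSup D φ ≤ C := by
  choose C hC using hD
  exact ⟨∑ i, C i, fun φ hφ => tvSup_le_sum fun i ψ hψ => hC i ψ fun x =>
    (hψ x).trans (NNReal.coe_le_coe.2 (hφ x))⟩

/-- The positive linear form `|μ| + μ`, twice the positive part of `μ`. -/
def absAddLin (μ : RadonMeasure X) : C_c(X, ℝ≥0) →ₗ[ℝ≥0] ℝ≥0 where
  toFun φ := ⟨tvSup (fun _ : Unit => μ) φ + μ.toLin φ.toReal,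
    neg_le_iff_add_nonneg'.1 (abs_le.1 (abs_toLin_toReal_le μ φ)).1⟩
  map_add' φ ψ := NNReal.eq <| by
    change tvSup _ (φ + ψ) + _ = tvSup _ φ + _ + (tvSup _ ψ + _)
    rw [tvSup_add, show (φ + ψ).toReal = φ.toReal + ψ.toReal from
      CompactlySupportedContinuousMap.toReal_add φ ψ, map_add, add_add_add_comm]
  map_smul' c φ := NNReal.eq <| by
    change tvSup _ (c • φ) + _ = (c : ℝ) * (tvSup _ φ + _)
    rw [tvSup_smul, CompactlySupportedContinuousMap.toReal_smul, NNReal.smul_def, map_smul,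
      smul_eq_mul, mul_add]

theorem coe_absAddLin (μ : RadonMeasure X) (φ : C_c(X, ℝ≥0)) :
    (absAddLin μ φ : ℝ) = tvLin (fun _ : Unit => μ) φ + μ.toLin φ.toReal := rfl

variable [T2Space X] [LocallyCompactSpace X] [MeasurableSpace X] [BorelSpace X]

instance {ι : Type*} [Fintype ι] (μ : ι → RadonMeasure X) : (totalVariation μ).Regular :=
  NNRealRMK.rieszMeasure_regular _

instance (μ : RadonMeasure X) : μ.abs.Regular := NNRealRMK.rieszMeasure_regular _

theorem integral_rieszMeasure_eq_sub (Λ : C_c(X, ℝ≥0) →ₗ[ℝ≥0] ℝ≥0) (φ : C_c(X, ℝ)) :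
    ∫ x, φ x ∂NNRealRMK.rieszMeasure Λ = Λ φ.nnrealPart - Λ (-φ).nnrealPart := by
  rw [← CompactlySupportedContinuousMap.toRealPositiveLinear_apply,
    ← RealRMK.integral_rieszMeasure, NNRealRMK.rieszMeasure, RealRMK.rieszMeasure,
    CompactlySupportedContinuousMap.eq_toNNRealLinear_toRealPositiveLinear]

theorem isFiniteMeasure_rieszMeasure [SigmaCompactSpace X] {Λ : C_c(X, ℝ≥0) →ₗ[ℝ≥0] ℝ≥0}
    {C : ℝ≥0} (hΛ : ∀ φ : C_c(X, ℝ≥0), (∀ x, φ x ≤ 1) → Λ φ ≤ C) :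
    IsFiniteMeasure (NNRealRMK.rieszMeasure Λ) := by
  refine ⟨lt_of_le_of_lt ?_ (ENNReal.coe_lt_top (r := C))⟩
  rw [MeasurableSet.univ.measure_eq_iSup_isCompact]
  refine iSup₂_le fun K _ => iSup_le fun hK => ?_
  obtain ⟨φ, hφ_one, -, hφ_le⟩ := exists_cc_eq_one_of_isCompact hK isOpen_univ (subset_univ _)
  refine (measure_le_lintegral_of_eq_one _ hK hφ_one).trans ?_
  rw [NNRealRMK.lintegral_rieszMeasure]
  exact ENNReal.coe_le_coe.2 (hΛ φ hφ_le)

theorem RadonMeasure.IsBounded.exists_isBoundedMeasure [SigmaCompactSpace X] {μ : RadonMeasure X}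
    (hμ : μ.IsBounded) : ∃ s : SignedMeasure X, μ.IsBoundedMeasure s := by
  obtain ⟨C, hC⟩ := IsBounded.exists_tvSup_le fun _ : Unit => hμ
  have habs : IsFiniteMeasure μ.abs := isFiniteMeasure_rieszMeasure (C := C.toNNReal)
    fun φ hφ => NNReal.coe_le_coe.1 ((hC φ hφ).trans (Real.le_coe_toNNReal C))
  have hadd : IsFiniteMeasure (NNRealRMK.rieszMeasure (absAddLin μ)) :=
    isFiniteMeasure_rieszMeasure (C := (C + C).toNNReal) fun φ hφ => NNReal.coe_le_coe.1
      ((add_le_add (hC φ hφ) ((le_abs_self _).trans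
        ((abs_toLin_toReal_le μ φ).trans (hC φ hφ)))).trans (Real.le_coe_toNNReal _))
  refine ⟨(NNRealRMK.rieszMeasure (absAddLin μ)).toSignedMeasure - μ.abs.toSignedMeasure,
    fun φ => ?_⟩
  rw [signedIntegral_sub_toSignedMeasure, RadonMeasure.abs, totalVariation,
    integral_rieszMeasure_eq_sub, integral_rieszMeasure_eq_sub, coe_absAddLin, coe_absAddLin]
  conv_lhs => rw [← φ.nnrealPart_sub_nnrealPart_neg, map_sub]
  ring

theorem RadonMeasure.isBoundedMeasure_of_test {N : ℕ} {μ : RadonMeasure (Euc N)}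
    {s : SignedMeasure (Euc N)} (h : ∀ φ : Test N, μ.toLin φ.toCc = signedIntegral s φ) :
    μ.IsBoundedMeasure s := by
  intro φ
  obtain ⟨C, hC⟩ := φ.continuous.bounded_above_of_compact_support φ.hasCompactSupport
  refine tendsto_nhds_unique (μ.tendsto_toLin_mollTest φ) ?_
  simp only [h]
  exact tendsto_signedIntegral s (fun n => (mollTest n φ).continuous.measurable)
    (abs_mollTest_le hC) fun x => (tendstoUniformly_mollTest φ).tendsto_at x

end Bounded

/-! ### Weak derivatives -/

section TestFunctions

variable {N : ℕ}

theorem integrable_mul_cc {f : Euc N → ℝ} (hf : LocallyIntegrable f) (φ : C_c(Euc N, ℝ)) :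
    Integrable fun x => f x * φ x := by
  simpa only [smul_eq_mul] using
    hf.integrable_smul_right_of_hasCompactSupport (map_continuous φ) φ.hasCompactSupport

theorem Test.integrable_mul (φ : Test N) {f : Euc N → ℝ} (hf : LocallyIntegrable f) :
    Integrable fun x => f x * φ x :=
  integrable_mul_cc hf φ.toCc

/-- The distribution given by a locally integrable function. -/
def integralCLM (f : Euc N → ℝ) : Test N →L[ℝ] ℝ :=
  TestFunction.integralAgainstBilinCLM (ContinuousLinearMap.mul ℝ ℝ) volume f

theorem integralCLM_apply {f : Euc N → ℝ} (hf : LocallyIntegrable f) (φ : Test N) :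
    integralCLM f φ = ∫ x, f x * φ x := by
  rw [integralCLM, TestFunction.integralAgainstBilinCLM_eq_integral (hf.locallyIntegrableOn _)]
  simp only [ContinuousLinearMap.mul_apply', mul_comm]

/-- The partial derivative `∂_i`, as a continuous linear map between test functions. -/
def partialCLM (i : Fin N) : Test N →L[ℝ] Test N :=
  TestFunction.lineDerivCLM ℝ (EuclideanSpace.single i 1)

theorem coe_partialCLM (i : Fin N) (φ : Test N) :
    (partialCLM i φ : Euc N → ℝ) = partialDeriv i φ := by
  funext x
  rw [partialCLM, TestFunction.lineDerivCLM_eq_fderivCLM,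
    TestFunction.fderivCLM_apply_of_le _ (by simp)]
  rfl

theorem integrable_mul_partialDeriv {f : Euc N → ℝ} (hf : LocallyIntegrable f) (i : Fin N)
    (φ : Test N) : Integrable fun x => f x * partialDeriv i φ x :=
  coe_partialCLM i φ ▸ (partialCLM i φ).integrable_mul hf

/-- The distributional derivative `∂_i u` of a locally integrable function. -/
def weakPartialCLM (i : Fin N) (u : Euc N → ℝ) : Test N →L[ℝ] ℝ :=
  -(integralCLM u ∘L partialCLM i)

theorem weakPartialCLM_apply {u : Euc N → ℝ} (hu : LocallyIntegrable u) (i : Fin N) (φ : Test N) :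
    weakPartialCLM i u φ = -∫ x, u x * partialDeriv i φ x := by
  rw [← coe_partialCLM, ← integralCLM_apply hu]
  rfl

theorem tsupport_partialDeriv (i : Fin N) (φ : Euc N → ℝ) :
    tsupport (partialDeriv i φ) ⊆ tsupport φ :=
  tsupport_fderiv_apply_subset ℝ _

theorem contDiff_partialDeriv {f : Euc N → ℝ} (hf : ContDiff ℝ (⊤ : ℕ∞) f) (i : Fin N) :
    ContDiff ℝ (⊤ : ℕ∞) (partialDeriv i f) :=
  (hf.fderiv_right (m := ((⊤ : ℕ∞) : WithTop ℕ∞)) (by simp)).clm_apply contDiff_const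

theorem exists_test_eq_one {K : Set (Euc N)} (hK : IsCompact K) :
    ∃ χ : Test N, ∀ x ∈ K, χ x = 1 := by
  obtain ⟨R, hR, hKR⟩ := hK.isBounded.subset_closedBall_lt 0 0
  let b : ContDiffBump (0 : Euc N) := ⟨R, R + 1, hR, lt_add_one R⟩
  exact ⟨mkTest b b.contDiff b.hasCompactSupport, fun x hx => b.one_of_mem_closedBall (hKR hx)⟩

/-- The product of a smooth function and a test function. -/
def mulTest (f : Euc N → ℝ) (hf : ContDiff ℝ (⊤ : ℕ∞) f) (φ : Test N) : Test N :=
  mkTest (fun x => f x * φ x) (hf.mul φ.contDiff) φ.hasCompactSupport.mul_left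

@[simp]
theorem mulTest_apply (f : Euc N → ℝ) (hf : ContDiff ℝ (⊤ : ℕ∞) f) (φ : Test N) (x : Euc N) :
    mulTest f hf φ x = f x * φ x := rfl

theorem partialDeriv_mulTest (f : Euc N → ℝ) (hf : ContDiff ℝ (⊤ : ℕ∞) f) (φ : Test N)
    (i : Fin N) (x : Euc N) :
    partialDeriv i (mulTest f hf φ) x = f x * partialDeriv i φ x + partialDeriv i f x * φ x := by
  have hmul : HasFDerivAt (mulTest f hf φ) _ x :=
    (hf.differentiable (by simp) x).hasFDerivAt.mul
      (φ.contDiff.differentiable (by simp) x).hasFDerivAt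
  simp [partialDeriv, hmul.fderiv, mul_comm]

theorem memLpLoc_of_test {u : Euc N → ℝ} {q : ℝ≥0∞}
    (h : ∀ χ : Test N, MemLp (fun x => χ x * u x) q) : MemLpLoc u q := by
  intro K hK
  obtain ⟨χ, hχ⟩ := exists_test_eq_one hK
  refine ((h χ).restrict K).ae_eq ?_
  filter_upwards [ae_restrict_mem hK.measurableSet] with x hx
  rw [hχ x hx, one_mul]

end TestFunctions

section MollifiedDivergence

variable {N : ℕ}

theorem partialDeriv_moll {f : Euc N → ℝ} (hf : LocallyIntegrable f) (n : ℕ) (i : Fin N)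
    (x : Euc N) :
    partialDeriv i (moll n f) x = ∫ y, f y * partialDeriv i (mollifier N n) (x - y) := by
  have hc := hasCompactSupport_mollifier (N := N) n
  have hd := contDiff_mollifier (N := N) n
  have hderiv := hc.hasFDerivAt_convolution_left (ContinuousLinearMap.lsmul ℝ ℝ)
    (hd.of_le (by exact_mod_cast le_top)) hf x
  have hint := (hc.fderiv ℝ).convolutionExists_left
    ((ContinuousLinearMap.lsmul ℝ ℝ).precompL (Euc N)) (hd.continuous_fderiv (by simp)) hf x
  rw [partialDeriv, moll, hderiv.fderiv, convolution_def, ContinuousLinearMap.integral_apply hint,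
    ← integral_sub_left_eq_self _ volume x]
  simp [ContinuousLinearMap.precompL_apply, partialDeriv, mul_comm]

/-- The mollifier centred at `x`, as a test function. -/
def mollifierAt (n : ℕ) (x : Euc N) : Test N :=
  mkTest (fun y => mollifier N n (x - y))
    ((contDiff_mollifier n).comp (contDiff_const.sub contDiff_id))
    ((hasCompactSupport_mollifier n).comp_homeomorph (Homeomorph.subLeft x))

theorem moll_eq_integral_mul_mollifierAt (n : ℕ) (f : Euc N → ℝ) (x : Euc N) :
    moll n f x = ∫ y, f y * mollifierAt n x y := by
  rw [moll_apply, ← integral_sub_left_eq_self _ volume x]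
  simp only [sub_sub_cancel, smul_eq_mul, mul_comm]
  rfl

theorem partialDeriv_mollifierAt (n : ℕ) (x : Euc N) (i : Fin N) (y : Euc N) :
    partialDeriv i (mollifierAt n x) y = -partialDeriv i (mollifier N n) (x - y) := by
  have h : HasFDerivAt (mollifierAt n x) _ y :=
    ((contDiff_mollifier n).differentiable (by simp) (x - y)).hasFDerivAt.comp y
      ((hasFDerivAt_id y).const_sub x)
  simp [partialDeriv, h.fderiv]

theorem sum_partialDeriv_moll {σ : Euc N → Euc N} {g : Euc N → ℝ} (h : IsWeakDiv σ g)
    (hσ : ∀ i, LocallyIntegrable fun x => σ x i) (n : ℕ) (x : Euc N) :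
    ∑ i, partialDeriv i (moll n fun y => σ y i) x = moll n g x := by
  rw [moll_eq_integral_mul_mollifierAt, h (mollifierAt n x)]
  simp only [dotGrad]
  rw [integral_finsetSum _ fun i _ => integrable_mul_partialDeriv (hσ i) i _]
  simp only [partialDeriv_moll (hσ _), partialDeriv_mollifierAt, mul_neg, integral_neg,
    Finset.sum_neg_distrib, neg_neg]

end MollifiedDivergence

section Localization

variable {N : ℕ}

theorem exists_forall_ae_eq {X β : Type*} [MeasurableSpace X] {μ : Measure X} {B : ℕ → Set X}
    (hB : ⋃ n, B n = univ) {d : ℕ → X → β}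
    (h : ∀ m n, m ≤ n → ∀ᵐ x ∂μ, x ∈ B m → d m x = d n x) :
    ∃ D : X → β, ∀ n, ∀ᵐ x ∂μ, x ∈ B n → D x = d n x := by
  classical
  have hmem : ∀ x, ∃ n, x ∈ B n := fun x => mem_iUnion.1 (hB.symm ▸ mem_univ x)
  refine ⟨fun x => d (Nat.find (hmem x)) x, fun n => ?_⟩
  filter_upwards [ae_all_iff.2 fun m => ae_all_iff.2 fun hm : m ≤ n => h m n hm] with x hx hxn
  exact hx _ (Nat.find_min' _ hxn) (Nat.find_spec (hmem x))

theorem integral_mul_congr_of_tsupport_subset {f₁ f₂ φ : Euc N → ℝ} {U : Set (Euc N)}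
    (hφ : tsupport φ ⊆ U) (h : ∀ᵐ x, x ∈ U → f₁ x = f₂ x) :
    ∫ x, f₁ x * φ x = ∫ x, f₂ x * φ x := by
  refine integral_congr_ae ?_
  filter_upwards [h] with x hx
  by_cases hxφ : x ∈ tsupport φ
  · rw [hx (hφ hxφ)]
  · rw [image_eq_zero_of_notMem_tsupport hxφ, mul_zero, mul_zero]

theorem integral_cutoff_mul_partialDeriv {χ φ : Test N} {U : Set (Euc N)}
    (hχ : ∀ x ∈ U, χ x = 1) (hφ : tsupport φ ⊆ U) (u : Euc N → ℝ) (i : Fin N) :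
    ∫ x, χ x * u x * partialDeriv i φ x = ∫ x, u x * partialDeriv i φ x :=
  integral_mul_congr_of_tsupport_subset ((tsupport_partialDeriv i φ).trans hφ)
    (.of_forall fun x hx => by rw [hχ x hx, one_mul])

theorem exists_isRadonPartial {u : Euc N → ℝ} (hu : LocallyIntegrable u) (i : Fin N)
    (h : ∀ χ : Test N, ∃ s : SignedMeasure (Euc N), IsBoundedPartial i (fun x => χ x * u x) s) :
    ∃ μ : RadonMeasure (Euc N), IsRadonPartial i u μ := by
  obtain ⟨μ, hμ⟩ := exists_radonMeasure_eq (L := (weakPartialCLM i u).toLinearMap)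
    fun K hK => by
      obtain ⟨χ, hχ⟩ := exists_test_eq_one hK
      obtain ⟨s, hs⟩ := h χ
      refine ⟨1 * s.totalVariation.real univ, fun φ hφK hφ => ?_⟩
      rw [ContinuousLinearMap.coe_coe, weakPartialCLM_apply hu,
        ← integral_cutoff_mul_partialDeriv hχ hφK, ← hs φ]
      exact abs_signedIntegral_le s hφ
  exact ⟨μ, fun φ => (hμ φ).trans (weakPartialCLM_apply hu i φ)⟩

theorem IsWeakPartial.ae_eq_of_eqOn {i : Fin N} {U : Set (Euc N)} (hU : IsOpen U)
    {u₁ u₂ d₁ d₂ : Euc N → ℝ} (hd₁ : LocallyIntegrable d₁) (hd₂ : LocallyIntegrable d₂)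
    (h₁ : IsWeakPartial i u₁ d₁) (h₂ : IsWeakPartial i u₂ d₂) (hu : EqOn u₁ u₂ U) :
    ∀ᵐ x, x ∈ U → d₁ x = d₂ x := by
  have hzero := hU.ae_eq_zero_of_integral_contDiff_smul_eq_zero
    ((hd₁.sub hd₂).locallyIntegrableOn U) fun ψ hψ hψc hψU => by
      let φ := mkTest ψ hψ hψc
      have hintegrals : ∫ x, d₁ x * φ x = ∫ x, d₂ x * φ x := by
        rw [h₁ φ, h₂ φ, integral_mul_congr_of_tsupport_subset
          ((tsupport_partialDeriv i φ).trans hψU) (.of_forall hu)]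
      rw [← sub_eq_zero, ← integral_sub (φ.integrable_mul hd₁) (φ.integrable_mul hd₂)]
        at hintegrals
      simpa only [φ, mkTest_apply, ← sub_mul, smul_eq_mul, mul_comm, Pi.sub_apply] using hintegrals
  filter_upwards [hzero] with x hx hxU using sub_eq_zero.1 (hx hxU)

theorem exists_isWeakPartial {u : Euc N → ℝ} {q : ℝ≥0∞} (hq : 1 ≤ q) (i : Fin N)
    (h : ∀ χ : Test N, ∃ d : Euc N → ℝ, MemLp d q ∧ IsWeakPartial i (fun x => χ x * u x) d) :
    ∃ d : Euc N → ℝ, MemLpLoc d q ∧ IsWeakPartial i u d := by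
  let B : ℕ → Set (Euc N) := fun n => Metric.ball 0 n
  have hBmono : Monotone B := fun m n hmn => Metric.ball_subset_ball (Nat.cast_le.2 hmn)
  have hBcover : ∀ K, IsCompact K → ∃ n, K ⊆ B n := fun K hK =>
    hK.elim_directed_cover B (fun n => Metric.isOpen_ball)
      (by rw [Metric.iUnion_ball_nat]; exact subset_univ K) hBmono.directed_le
  choose χ hχ using fun n : ℕ => exists_test_eq_one (isCompact_closedBall (0 : Euc N) n)
  replace hχ : ∀ n, ∀ x ∈ B n, χ n x = 1 := fun n x hx =>
    hχ n x (Metric.ball_subset_closedBall hx)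
  choose d hd hdw using fun n => h (χ n)
  obtain ⟨D, hD⟩ := exists_forall_ae_eq (Metric.iUnion_ball_nat (0 : Euc N)) (d := d)
    fun m n hmn => (hdw m).ae_eq_of_eqOn Metric.isOpen_ball ((hd m).locallyIntegrable hq)
      ((hd n).locallyIntegrable hq) (hdw n) fun x hx => by
        simp only [hχ m x hx, hχ n x (hBmono hmn hx)]
  refine ⟨D, fun K hK => ?_, fun φ => ?_⟩
  · obtain ⟨n, hn⟩ := hBcover K hK
    refine ((hd n).restrict K).ae_eq ?_
    filter_upwards [ae_restrict_of_ae (hD n), ae_restrict_mem hK.measurableSet] with x hx hxK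
    exact (hx (hn hxK)).symm
  · obtain ⟨n, hn⟩ := hBcover _ φ.hasCompactSupport
    rw [integral_mul_congr_of_tsupport_subset hn (hD n), hdw n φ,
      integral_cutoff_mul_partialDeriv (hχ n) hn]

end Localization

section Density

variable {N : ℕ} (S : RadonMeasure (Euc N)) {g : Euc N → ℝ}

theorem abs_integral_mul_le_of_abs_le_one {X : Type*} [MeasurableSpace X] {μ : Measure X}
    {g f : X → ℝ} (hg : Integrable g μ) (hf : ∀ x, |f x| ≤ 1) :
    |∫ x, g x * f x ∂μ| ≤ ∫ x, ‖g x‖ ∂μ := by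
  rw [← Real.norm_eq_abs]
  refine norm_integral_le_of_norm_le hg.norm (.of_forall fun x => ?_)
  rw [norm_mul]
  exact mul_le_of_le_one_right (norm_nonneg _) (hf x)

/-- The sum of a Radon measure and of a measure with locally integrable density. -/
def RadonMeasure.addDensity (hg : LocallyIntegrable g) : RadonMeasure (Euc N) where
  toLin := S.toLin +
    { toFun := fun φ => ∫ x, g x * φ x
      map_add' := fun φ ψ => by
        simp only [CompactlySupportedContinuousMap.add_apply, mul_add]
        exact integral_add (integrable_mul_cc hg φ) (integrable_mul_cc hg ψ)
      map_smul' := fun c φ => by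
        simp only [CompactlySupportedContinuousMap.smul_apply, smul_eq_mul, mul_left_comm _ c,
          integral_const_mul, RingHom.id_apply] }
  bound K hK := by
    obtain ⟨C, hC⟩ := S.bound K hK
    refine ⟨C + ∫ x in K, ‖g x‖, fun φ hφK hφ =>
      (abs_add_le _ _).trans (add_le_add (hC φ hφK hφ) ?_)⟩
    have hrestrict : ∫ x in K, g x * φ x = ∫ x, g x * φ x :=
      setIntegral_eq_integral_of_forall_compl_eq_zero fun x hx => by
        rw [image_eq_zero_of_notMem_tsupport fun h => hx (hφK h), mul_zero]
    exact hrestrict ▸ abs_integral_mul_le_of_abs_le_one (hg.integrableOn_isCompact hK) hφ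

theorem RadonMeasure.addDensity_apply (hg : LocallyIntegrable g) (φ : C_c(Euc N, ℝ)) :
    (S.addDensity hg).toLin φ = S.toLin φ + ∫ x, g x * φ x := rfl

variable {S}

theorem RadonMeasure.IsBounded.addDensity (hS : S.IsBounded) (hg : LocallyIntegrable g)
    (hgi : Integrable g) : (S.addDensity hg).IsBounded :=
  let ⟨C, hC⟩ := hS
  ⟨C + ∫ x, ‖g x‖, fun φ hφ => (abs_add_le _ _).trans
    (add_le_add (hC φ hφ) (abs_integral_mul_le_of_abs_le_one hgi hφ))⟩

end Density

/-! ### Domination by a total variation -/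

section Domination

theorem ae_norm_le_toNNReal_eLpNorm {X E : Type*} [MeasurableSpace X] [NormedAddCommGroup E]
    {μ : Measure X} {τ : X → E} (hτ : MemLp τ ∞ μ) :
    ∀ᵐ y ∂μ, ‖τ y‖ ≤ (eLpNorm τ ∞ μ).toNNReal := by
  filter_upwards [ae_le_eLpNormEssSup (f := τ) (μ := μ)] with y hy
  rw [← eLpNorm_exponent_top, ← ENNReal.coe_toNNReal hτ.eLpNorm_ne_top] at hy
  exact_mod_cast hy

theorem tsupport_subset_tsupport_of_abs_le {X : Type*} [TopologicalSpace X]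
    {φ : X → ℝ≥0} {ψ : X → ℝ} (h : ∀ x, |ψ x| ≤ φ x) :
    tsupport ψ ⊆ tsupport φ :=
  closure_mono fun x hx h0 => hx (abs_nonpos_iff.1 ((h x).trans (by rw [h0, NNReal.coe_zero])))

variable {X E ι : Type*} [TopologicalSpace X] [MeasurableSpace X] [NormedAddCommGroup E]
  [Fintype ι]

/-- `|⟨S, φ⟩| ≤ ‖τ‖_{L^∞(supp φ)} ⟨|D|, |φ|⟩` for every `φ` in `C_c(X)`. The norm of `τ` is replaced
by an upper bound `M`, so that the inequality is void when `τ` is unbounded on `supp φ`. -/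
def IsDominated (μ : Measure X) (S : RadonMeasure X) (τ : X → E) (D : ι → RadonMeasure X) : Prop :=
  ∀ (φ : C_c(X, ℝ)) (M : ℝ≥0), (∀ᵐ y ∂μ, y ∈ tsupport φ → ‖τ y‖ ≤ M) →
    |S.toLin φ| ≤ M * tvSup D (absCc φ)

variable {μ : Measure X} {S : RadonMeasure X} {τ : X → E} {D : ι → RadonMeasure X} {M : ℝ≥0}

theorem IsDominated.tvSup_le (h : IsDominated μ S τ D) {φ : C_c(X, ℝ≥0)}
    (hM : ∀ᵐ y ∂μ, y ∈ tsupport φ → ‖τ y‖ ≤ M) :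
    tvSup (fun _ : Unit => S) φ ≤ M * tvSup D φ := by
  refine (tvSup_le_sum (B := fun _ => M * tvSup D φ) fun _ ψ hψ => ?_).trans_eq (by simp)
  have hψM : ∀ᵐ y ∂μ, y ∈ tsupport ψ → ‖τ y‖ ≤ M := hM.mono fun y hy hyψ =>
    hy (tsupport_subset_tsupport_of_abs_le hψ hyψ)
  refine (h ψ M hψM).trans (mul_le_mul_of_nonneg_left (tvSup_mono D fun x => ?_) M.coe_nonneg)
  exact NNReal.coe_le_coe.1 ((absCc_apply ψ x).trans_le (hψ x))

theorem IsDominated.isBounded (h : IsDominated μ S τ D) (hM : ∀ᵐ y ∂μ, ‖τ y‖ ≤ M)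
    (hD : ∀ i, (D i).IsBounded) : S.IsBounded := by
  obtain ⟨C, hC⟩ := RadonMeasure.IsBounded.exists_tvSup_le hD
  refine ⟨M * C, fun φ hφ => (h φ M (hM.mono fun _ hy _ => hy)).trans ?_⟩
  refine mul_le_mul_of_nonneg_left (hC _ fun x => ?_) M.coe_nonneg
  exact NNReal.coe_le_coe.1 ((absCc_apply φ x).trans_le (hφ x))

variable [T2Space X] [LocallyCompactSpace X] [BorelSpace X]

theorem IsDominated.lintegral_le (h : IsDominated μ S τ D) {φ : C_c(X, ℝ≥0)}
    (hM : ∀ᵐ y ∂μ, y ∈ tsupport φ → ‖τ y‖ ≤ M) :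
    ∫⁻ x, φ x ∂S.abs ≤ M * ∫⁻ x, φ x ∂totalVariation D := by
  rw [RadonMeasure.abs, lintegral_totalVariation, lintegral_totalVariation,
    ← ENNReal.ofReal_coe_nnreal, ← ENNReal.ofReal_mul M.coe_nonneg]
  exact ENNReal.ofReal_le_ofReal (h.tvSup_le hM)

theorem IsDominated.lintegral_le_eLpNorm (h : IsDominated μ S τ D) {φ : C_c(X, ℝ≥0)}
    (hτ : MemLp τ ∞ (μ.restrict (tsupport φ))) :
    ∫⁻ x, φ x ∂S.abs ≤
      eLpNorm τ ∞ (μ.restrict (tsupport φ)) * ∫⁻ x, φ x ∂totalVariation D := by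
  rw [← ENNReal.coe_toNNReal hτ.eLpNorm_ne_top]
  exact h.lintegral_le
    ((ae_restrict_iff' (isClosed_tsupport φ).measurableSet).1 (ae_norm_le_toNNReal_eLpNorm hτ))

variable [SigmaCompactSpace X]

theorem IsDominated.abs_restrict_le (h : IsDominated μ S τ D) {W : Set X} (hW : IsOpen W)
    (hM : ∀ᵐ y ∂μ, y ∈ W → ‖τ y‖ ≤ M) :
    S.abs.restrict W ≤ (M • totalVariation D).restrict W := by
  refine restrict_le_restrict_of_lintegral_le hW fun φ hφ => ?_
  rw [lintegral_smul_measure]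
  exact h.lintegral_le (hM.mono fun y hy hyφ => hy (hφ hyφ))

theorem IsDominated.abs_le_smul (h : IsDominated μ S τ D) (hτ : MemLp τ ∞ μ) :
    S.abs ≤ eLpNorm τ ∞ μ • totalVariation D := by
  have hle := h.abs_restrict_le isOpen_univ
    ((ae_norm_le_toNNReal_eLpNorm hτ).mono fun _ hy _ => hy)
  rw [Measure.restrict_univ, Measure.restrict_univ] at hle
  refine hle.trans_eq ?_
  conv_rhs => rw [← ENNReal.coe_toNNReal hτ.eLpNorm_ne_top]
  rfl

theorem IsDominated.absolutelyContinuous [SecondCountableTopology X] (h : IsDominated μ S τ D)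
    (hτ : ∀ K, IsCompact K → MemLp τ ∞ (μ.restrict K)) : S.abs ≪ totalVariation D := by
  intro A hA
  refine measure_null_of_locally_null A fun x _ => ?_
  obtain ⟨K, hK, hKx⟩ := exists_compact_mem_nhds x
  have hM := (ae_restrict_iff' hK.measurableSet).1 (ae_norm_le_toNNReal_eLpNorm (hτ K hK))
  refine ⟨A ∩ interior K, inter_mem_nhdsWithin A (interior_mem_nhds.2 hKx), ?_⟩
  rw [← Measure.restrict_apply₀' isOpen_interior.nullMeasurableSet]
  refine nonpos_iff_eq_zero.1 ((h.abs_restrict_le isOpen_interior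
    (hM.mono fun y hy hyK => hy (interior_subset hyK)) A).trans ?_)
  refine (Measure.restrict_apply_le _ A).trans ?_
  rw [Measure.smul_apply, hA, smul_zero]

end Domination

section DotProduct

variable {X ι : Type*} [TopologicalSpace X] [Fintype ι]

/-- The vector measure `f · D` with continuous density `f`. -/
def dotLin (D : ι → RadonMeasure X) (f : ι → C(X, ℝ)) : C_c(X, ℝ) →ₗ[ℝ] ℝ where
  toFun φ := ∑ j, (D j).toLin (f j • φ)
  map_add' φ ψ := by
    rw [← Finset.sum_add_distrib]
    refine Finset.sum_congr rfl fun j _ => ?_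
    rw [← map_add]
    exact congrArg (D j).toLin (by ext x; simp [mul_add])
  map_smul' c φ := by
    rw [RingHom.id_apply, Finset.smul_sum]
    refine Finset.sum_congr rfl fun j _ => ?_
    rw [← map_smul]
    exact congrArg (D j).toLin (by ext x; simp [mul_left_comm])

theorem dotLin_apply (D : ι → RadonMeasure X) (f : ι → C(X, ℝ)) (φ : C_c(X, ℝ)) :
    dotLin D f φ = ∑ j, (D j).toLin (f j • φ) := rfl

theorem abs_dotLin_le (D : ι → RadonMeasure X) {f : ι → C(X, ℝ)} {φ : C_c(X, ℝ)} {M : ℝ≥0}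
    (hM : ∀ x ∈ tsupport φ, ∑ j, f j x ^ 2 ≤ (M : ℝ) ^ 2) :
    |dotLin D f φ| ≤ M * tvSup D (absCc φ) := by
  rw [dotLin_apply, ← tvSup_smul]
  refine abs_sum_le_tvSup D _ _ fun x => ?_
  by_cases hx : x ∈ tsupport φ
  · simpa [mul_pow, ← Finset.sum_mul] using
      mul_le_mul_of_nonneg_right (hM x hx) (sq_nonneg (φ x))
  · simp [image_eq_zero_of_notMem_tsupport hx]

/-- The soft threshold of `φ` at level `ε`: a uniform approximation of `φ` below `|φ|`, with support
in the interior of that of `φ`. It leaves room for a mollification inside `supp φ`. -/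
def softThreshold (ε : ℝ) (φ : C_c(X, ℝ)) : C_c(X, ℝ) :=
  φ.compLeft ⟨fun t => t - max (-ε) (min ε t), by fun_prop⟩

theorem softThreshold_apply {ε : ℝ} (hε : 0 ≤ ε) (φ : C_c(X, ℝ)) (x : X) :
    softThreshold ε φ x = φ x - max (-ε) (min ε (φ x)) :=
  CompactlySupportedContinuousMap.compLeft_apply (by simp [hε]) φ x

theorem abs_softThreshold_le {ε : ℝ} (hε : 0 ≤ ε) (φ : C_c(X, ℝ)) (x : X) :
    |softThreshold ε φ x| ≤ |φ x| := by
  rw [softThreshold_apply hε]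
  grind

theorem abs_softThreshold_sub_le {ε : ℝ} (hε : 0 ≤ ε) (φ : C_c(X, ℝ)) (x : X) :
    |softThreshold ε φ x - φ x| ≤ ε := by
  rw [softThreshold_apply hε]
  grind

theorem tsupport_softThreshold_subset {ε : ℝ} (hε : 0 < ε) (φ : C_c(X, ℝ)) :
    tsupport (softThreshold ε φ) ⊆ Function.support φ := by
  have hclosed : IsClosed {x | ε ≤ |φ x|} :=
    isClosed_le continuous_const (map_continuous φ).abs
  refine (closure_minimal (fun x hx => ?_) hclosed).trans fun x (hx : ε ≤ |φ x|) h0 => ?_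
  · by_contra hlt
    refine hx ?_
    rw [softThreshold_apply hε.le]
    grind
  · rw [h0, abs_zero] at hx
    exact hx.not_gt hε

theorem RadonMeasure.abs_toLin_le_of_softThreshold (S : RadonMeasure X) {φ : C_c(X, ℝ)} {C : ℝ}
    (h : ∀ ε > 0, |S.toLin (softThreshold ε φ)| ≤ C) : |S.toLin φ| ≤ C := by
  have hpos (n : ℕ) : 0 < 1 / ((n : ℝ) + 1) := Nat.one_div_pos_of_nat
  have hlim :
      TendstoUniformly (fun (n : ℕ) x => softThreshold (1 / ((n : ℝ) + 1)) φ x) φ atTop := by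
    refine Metric.tendstoUniformly_iff.2 fun ε hε => ?_
    filter_upwards [(tendsto_one_div_add_atTop_nhds_zero_nat (𝕜 := ℝ)).eventually_lt_const hε]
      with n hn x
    rw [dist_comm, Real.dist_eq]
    exact (abs_softThreshold_sub_le (hpos n).le φ x).trans_lt hn
  exact le_of_tendsto (S.tendsto_toLin φ.hasCompactSupport (fun n =>
    (tsupport_softThreshold_subset (hpos n) φ).trans (subset_tsupport φ)) Subset.rfl hlim).abs
    (.of_forall fun n => h _ (hpos n))

end DotProduct

section DominatedLimit

variable {N m : ℕ} {τ : Euc N → Euc m} (hτ : LocallyIntegrable τ) (D : Fin m → RadonMeasure (Euc N))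

/-- The measure `τ_n · D`, where `τ_n` is the mollification of `τ` at scale `1 / (n + 1)`. -/
def mollDot (n : ℕ) : C_c(Euc N, ℝ) →ₗ[ℝ] ℝ :=
  dotLin D fun j => ⟨fun x => moll n τ x j, by
    have := (contDiff_moll hτ n).continuous
    fun_prop⟩

theorem mollDot_toCc (n : ℕ) (φ : Test N) (hτj : ∀ j, LocallyIntegrable fun y => τ y j) :
    mollDot hτ D n φ.toCc = ∑ j, (D j).toLin (mulTest _ (contDiff_moll (hτj j) n) φ).toCc := by
  rw [mollDot, dotLin_apply]
  refine Finset.sum_congr rfl fun j _ => congrArg (D j).toLin ?_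
  ext x
  exact congrArg (· * φ x) (moll_proj hτ n x j)

theorem abs_mollDot_le {n : ℕ} {φ : C_c(Euc N, ℝ)} {M : ℝ≥0}
    (hM : ∀ x ∈ tsupport φ, ∀ᵐ y, y ∈ Metric.ball x (1 / ((n : ℝ) + 1)) → ‖τ y‖ ≤ M) :
    |mollDot hτ D n φ| ≤ M * tvSup D (absCc φ) := by
  refine abs_dotLin_le D fun x hx => ?_
  exact (EuclideanSpace.real_norm_sq_eq (moll n τ x)).symm.trans_le <|
    pow_le_pow_left₀ (norm_nonneg _) (norm_moll_le (hM x hx)) 2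

variable {D}

theorem isDominated_of_tendsto_mollDot {S : RadonMeasure (Euc N)}
    (hS : ∀ φ, Tendsto (fun n => mollDot hτ D n φ) atTop (𝓝 (S.toLin φ))) :
    IsDominated volume S τ D := by
  intro φ M hM
  refine S.abs_toLin_le_of_softThreshold fun ε hε => ?_
  set ψ := softThreshold ε φ
  obtain ⟨δ, hδ, hδφ⟩ := ψ.hasCompactSupport.isCompact.exists_thickening_subset_open
    (map_continuous φ).isOpen_support (tsupport_softThreshold_subset hε φ)
  have hψφ : tvSup D (absCc ψ) ≤ tvSup D (absCc φ) := tvSup_mono D fun x => by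
    rw [← NNReal.coe_le_coe, absCc_apply, absCc_apply]
    exact abs_softThreshold_le hε.le φ x
  refine (le_of_tendsto (hS ψ).abs ?_).trans (mul_le_mul_of_nonneg_left hψφ M.coe_nonneg)
  filter_upwards [(tendsto_one_div_add_atTop_nhds_zero_nat (𝕜 := ℝ)).eventually_lt_const hδ]
    with n hn
  refine abs_mollDot_le hτ D fun x hx => hM.mono fun y hy hyx => hy (subset_tsupport _ (hδφ ?_))
  exact Metric.ball_subset_thickening hx δ (Metric.ball_subset_ball hn.le hyx)

theorem exists_isDominated_of_tendsto_mollDot (hτ' : MemLpLoc τ ∞)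
    (h : ∀ φ : Test N, ∃ l, Tendsto (fun n => mollDot hτ D n φ.toCc) atTop (𝓝 l)) :
    ∃ S : RadonMeasure (Euc N), IsDominated volume S τ D ∧
      ∀ φ : Test N, Tendsto (fun n => mollDot hτ D n φ.toCc) atTop (𝓝 (S.toLin φ.toCc)) := by
  obtain ⟨S, hS⟩ := exists_radonMeasure_of_tendsto (A := mollDot hτ D) (fun K hK => by
    obtain ⟨C, hC⟩ := exists_tvSup_le_of_tsupport_subset D hK
    have hK1 : IsCompact (Metric.cthickening 1 K) := hK.cthickening
    have hM := (ae_restrict_iff' hK1.measurableSet).1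
      (ae_norm_le_toNNReal_eLpNorm (hτ' _ hK1))
    refine ⟨_ * C, fun n φ hφK hφ => (abs_mollDot_le hτ D fun x hx => hM.mono fun y hy hyx =>
      hy (ball_one_div_subset_cthickening_one (hφK hx) n hyx)).trans
      (mul_le_mul_of_nonneg_left (hC _ ?_ fun x => ?_) (NNReal.coe_nonneg _))⟩
    · exact tsupport_absCc φ ▸ hφK
    · exact NNReal.coe_le_coe.1 ((absCc_apply φ x).trans_le (hφ x))) h
  exact ⟨S, isDominated_of_tendsto_mollDot hτ hS, fun φ => hS _⟩

end DominatedLimit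

/-! ### The distribution `σ · ∇u` -/

section Transport

variable {N : ℕ} {σ : Euc N → Euc N} {g u : Euc N → ℝ}

/-- The distribution `φ ↦ -∫ g u φ - ∫ (σ · ∇φ) u`, which is `σ · ∇u` when `g = div σ`. -/
def transportCLM (σ : Euc N → Euc N) (g u : Euc N → ℝ) : Test N →L[ℝ] ℝ :=
  -integralCLM (fun x => g x * u x) - ∑ i, integralCLM (fun x => σ x i * u x) ∘L partialCLM i

theorem dotGrad_mul (σ : Euc N → Euc N) (u φ : Euc N → ℝ) (x : Euc N) :
    dotGrad σ φ x * u x = ∑ i, σ x i * u x * partialDeriv i φ x := by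
  rw [dotGrad, Finset.sum_mul]
  exact Finset.sum_congr rfl fun i _ => mul_right_comm _ _ _

theorem integrable_dotGrad_mul (h : ∀ i, LocallyIntegrable fun x => σ x i * u x) (φ : Test N) :
    Integrable fun x => dotGrad σ φ x * u x := by
  simp only [dotGrad_mul]
  exact integrable_finsetSum _ fun i _ => integrable_mul_partialDeriv (h i) i φ

theorem integral_dotGrad_mul (h : ∀ i, LocallyIntegrable fun x => σ x i * u x) (φ : Test N) :
    ∫ x, dotGrad σ φ x * u x = ∑ i, ∫ x, σ x i * u x * partialDeriv i φ x := by
  simp only [dotGrad_mul]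
  exact integral_finsetSum _ fun i _ => integrable_mul_partialDeriv (h i) i φ

theorem transportCLM_apply (hg : LocallyIntegrable fun x => g x * u x)
    (h : ∀ i, LocallyIntegrable fun x => σ x i * u x) (φ : Test N) :
    transportCLM σ g u φ = -(∫ x, g x * (u x * φ x)) - ∫ x, dotGrad σ φ x * u x := by
  rw [integral_dotGrad_mul h]
  simp only [transportCLM, ← mul_assoc, ← integralCLM_apply hg, ← coe_partialCLM,
    ← integralCLM_apply (h _), sub_apply, neg_apply,
    sum_apply, ContinuousLinearMap.comp_apply]

theorem integral_mul_partialDeriv_mulTest {f : Euc N → ℝ} (hu : LocallyIntegrable u)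
    (hf : ContDiff ℝ (⊤ : ℕ∞) f) (φ : Test N) (i : Fin N) :
    ∫ x, u x * partialDeriv i (mulTest f hf φ) x =
      (∫ x, f x * (u x * partialDeriv i φ x)) + ∫ x, partialDeriv i f x * (u x * φ x) := by
  have hint₁ : Integrable fun x => f x * (u x * partialDeriv i φ x) := by
    simpa only [mulTest_apply, mul_left_comm, coe_partialCLM] using
      (mulTest f hf (partialCLM i φ)).integrable_mul hu
  have hint₂ : Integrable fun x => partialDeriv i f x * (u x * φ x) := by
    simpa only [mulTest_apply, mul_left_comm] using
      (mulTest _ (contDiff_partialDeriv hf i) φ).integrable_mul hu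
  rw [← integral_add hint₁ hint₂]
  simp only [partialDeriv_mulTest, mul_add, mul_left_comm]

theorem sum_integral_mul_partialDeriv_mulTest_moll (hdiv : IsWeakDiv σ g)
    (hσ : ∀ i, LocallyIntegrable fun x => σ x i) (hu : LocallyIntegrable u) (n : ℕ) (φ : Test N) :
    ∑ i, -∫ x, u x * partialDeriv i (mulTest _ (contDiff_moll (hσ i) n) φ) x =
      -(∫ x, moll n g x * (u x * φ x))
        - ∑ i, ∫ x, moll n (fun y => σ y i) x * (u x * partialDeriv i φ x) := by
  have hint (i : Fin N) :
      Integrable fun x => partialDeriv i (moll n fun y => σ y i) x * (u x * φ x) := by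
    simpa only [mulTest_apply, mul_left_comm] using
      (mulTest _ (contDiff_partialDeriv (contDiff_moll (hσ i) n) i) φ).integrable_mul hu
  have hsum : ∫ x, moll n g x * (u x * φ x) =
      ∑ i, ∫ x, partialDeriv i (moll n fun y => σ y i) x * (u x * φ x) := by
    rw [← integral_finsetSum _ fun i _ => hint i]
    simp only [← sum_partialDeriv_moll hdiv hσ, Finset.sum_mul]
  simp only [integral_mul_partialDeriv_mulTest hu, Finset.sum_neg_distrib,
    Finset.sum_add_distrib, hsum]
  ring

theorem tendsto_sum_integral_mul_partialDeriv_mulTest_moll {p q : ℝ≥0∞} [p.HolderConjugate q]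
    (hp : p ≠ ∞) (hdiv : IsWeakDiv σ g) (hg : MemLpLoc g q)
    (hσq : ∀ i, MemLpLoc (fun x => σ x i) q) (hu : MemLpLoc u p)
    (hσ : ∀ i, LocallyIntegrable fun x => σ x i) (φ : Test N) :
    Tendsto
      (fun n => ∑ i, -∫ x, u x * partialDeriv i (mulTest _ (contDiff_moll (hσ i) n) φ) x)
      atTop (𝓝 (transportCLM σ g u φ)) := by
  have hσu (i : Fin N) := (hσq i).locallyIntegrable_mul (p := q) (q := p) hu
  rw [transportCLM_apply (hg.locallyIntegrable_mul hu) hσu, integral_dotGrad_mul hσu]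
  simp only [sum_integral_mul_partialDeriv_mulTest_moll hdiv hσ
    (hu.locallyIntegrable (ENNReal.HolderConjugate.one_le p q)), mul_assoc]
  refine Tendsto.sub (Tendsto.neg ?_) (tendsto_finsetSum _ fun i _ => ?_)
  · exact tendsto_integral_moll_mul hp
      (hu.mul_of_hasCompactSupport φ.continuous φ.hasCompactSupport)
      φ.hasCompactSupport.mul_left hg
  · rw [← coe_partialCLM]
    exact tendsto_integral_moll_mul hp
      (hu.mul_of_hasCompactSupport (partialCLM i φ).continuous (partialCLM i φ).hasCompactSupport)
      (partialCLM i φ).hasCompactSupport.mul_left (hσq i)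

theorem tendsto_integral_mul_partialDeriv_mulTest_moll {p q : ℝ≥0∞} [p.HolderConjugate q]
    (hp : p ≠ ∞) {i : Fin N} {d f : Euc N → ℝ} (hd : MemLpLoc d p) (hud : IsWeakPartial i u d)
    (hf : MemLpLoc f q) (hf' : LocallyIntegrable f) (φ : Test N) :
    Tendsto (fun n => -∫ x, u x * partialDeriv i (mulTest _ (contDiff_moll hf' n) φ) x)
      atTop (𝓝 (∫ x, f x * d x * φ x)) := by
  simp only [← hud _, mulTest_apply, mul_left_comm (d _), mul_assoc]
  exact tendsto_integral_moll_mul hp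
    (hd.mul_of_hasCompactSupport φ.continuous φ.hasCompactSupport)
    φ.hasCompactSupport.mul_left hf

end Transport

section FirstCoordinates

variable {N N₁ : ℕ} (hN : N₁ ≤ N)

/-- The gradient of `u`, with `∇₁u` the vector measure `D` and with `∂_i u` the function `d i` of
`L^{P i}_loc` for the other indices `i`. -/
structure IsGradient (P : Fin N → ℝ≥0∞) (u : Euc N → ℝ) (D : Fin N₁ → RadonMeasure (Euc N))
    (d : Fin N → Euc N → ℝ) : Prop where
  isRadonPartial : ∀ j, IsRadonPartial (Fin.castLE hN j) u (D j)
  memLpLoc : ∀ i : Fin N, N₁ ≤ (i : ℕ) → MemLpLoc (d i) (P i)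
  isWeakPartial : ∀ i : Fin N, N₁ ≤ (i : ℕ) → IsWeakPartial i u (d i)

/-- The vector field `σ` has divergence `g`, with local integrability of exponents `∞` for `σ¹`,
`Q i` for the component `σ_i` when `N₁ ≤ i`, and `q` for `g`. -/
structure IsDivField (Q : Fin N → ℝ≥0∞) (q : ℝ≥0∞) (σ : Euc N → Euc N) (g : Euc N → ℝ) :
    Prop where
  memLpLoc_firstProj : MemLpLoc (firstProj hN σ) ∞
  memLpLoc : ∀ i : Fin N, N₁ ≤ (i : ℕ) → MemLpLoc (fun x => σ x i) (Q i)
  isWeakDiv : IsWeakDiv σ g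
  memLpLoc_div : MemLpLoc g q

theorem sum_eq_sum_castLE_add_sum_filter {M : Type*} [AddCommMonoid M] (f : Fin N → M) :
    ∑ i, f i = ∑ j : Fin N₁, f (Fin.castLE hN j)
      + ∑ i ∈ Finset.univ.filter (fun i : Fin N => N₁ ≤ (i : ℕ)), f i := by
  rw [← Finset.sum_filter_add_sum_filter_not Finset.univ (fun i : Fin N => (i : ℕ) < N₁)]
  simp only [not_lt]
  congr 1
  refine (Finset.sum_bij (fun j _ => Fin.castLE hN j) (by simp) (by simp) (fun i hi => ?_)
    (by simp)).symm
  exact ⟨⟨i, (Finset.mem_filter.1 hi).2⟩, Finset.mem_univ _, rfl⟩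

variable {hN}

theorem memLp_apply_of_firstProj {σ : Euc N → Euc N} {q : ℝ≥0∞} {μ : Measure (Euc N)}
    (h : MemLp (firstProj hN σ) q μ) {i : Fin N} (hi : (i : ℕ) < N₁) :
    MemLp (fun x => σ x i) q μ :=
  (EuclideanSpace.proj (𝕜 := ℝ) (⟨i, hi⟩ : Fin N₁)).comp_memLp' h

variable {P Q : Fin N → ℝ≥0∞} {p q : ℝ≥0∞} {σ : Euc N → Euc N} {g u : Euc N → ℝ}
  {D : Fin N₁ → RadonMeasure (Euc N)} {d : Fin N → Euc N → ℝ}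

theorem IsDivField.memLpLoc_apply (hσ : IsDivField hN Q q σ g)
    (hqQ : ∀ i : Fin N, N₁ ≤ (i : ℕ) → q ≤ Q i) (i : Fin N) : MemLpLoc (fun x => σ x i) q := by
  rcases lt_or_ge (i : ℕ) N₁ with hi | hi
  · exact MemLpLoc.mono_exponent le_top fun K hK =>
      memLp_apply_of_firstProj (hσ.memLpLoc_firstProj K hK) hi
  · exact (hσ.memLpLoc i hi).mono_exponent (hqQ i hi)

theorem IsDivField.locallyIntegrable_apply (hσ : IsDivField hN Q q σ g) (hq : 1 ≤ q)
    (hqQ : ∀ i : Fin N, N₁ ≤ (i : ℕ) → q ≤ Q i) (i : Fin N) :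
    LocallyIntegrable fun x => σ x i :=
  (hσ.memLpLoc_apply hqQ i).locallyIntegrable hq

theorem IsGradient.locallyIntegrable_mul (hu : IsGradient hN P u D d) (hσ : IsDivField hN Q q σ g)
    (hPQ : ∀ i : Fin N, N₁ ≤ (i : ℕ) → (P i).HolderConjugate (Q i)) (i : Fin N)
    (hi : N₁ ≤ (i : ℕ)) : LocallyIntegrable fun x => σ x i * d i x :=
  have := (hPQ i hi).symm
  (hσ.memLpLoc i hi).locallyIntegrable_mul (hu.memLpLoc i hi)

/-- The part `∑_{i ≥ N₁} σ_i ∂_i u` of `σ · ∇u` that does not involve `∇₁u`, with `d i` for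
`∂_i u`. -/
def restDot (N₁ : ℕ) (σ : Euc N → Euc N) (d : Fin N → Euc N → ℝ) (x : Euc N) : ℝ :=
  ∑ i ∈ Finset.univ.filter (fun i : Fin N => N₁ ≤ (i : ℕ)), σ x i * d i x

theorem IsGradient.locallyIntegrable_restDot (hu : IsGradient hN P u D d)
    (hσ : IsDivField hN Q q σ g)
    (hPQ : ∀ i : Fin N, N₁ ≤ (i : ℕ) → (P i).HolderConjugate (Q i)) :
    LocallyIntegrable (restDot N₁ σ d) :=
  locallyIntegrable_finsetSum _ fun i hi =>
    hu.locallyIntegrable_mul hσ hPQ i (Finset.mem_filter.1 hi).2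

theorem integral_restDot_mul
    (h : ∀ i : Fin N, N₁ ≤ (i : ℕ) → LocallyIntegrable fun x => σ x i * d i x)
    (φ : C_c(Euc N, ℝ)) :
    ∫ x, restDot N₁ σ d x * φ x =
      ∑ i ∈ Finset.univ.filter (fun i : Fin N => N₁ ≤ (i : ℕ)), ∫ x, σ x i * d i x * φ x := by
  simp only [restDot, Finset.sum_mul]
  exact integral_finsetSum _ fun i hi => integrable_mul_cc (h i (Finset.mem_filter.1 hi).2) φ

theorem IsGradient.tendsto_mollDot [p.HolderConjugate q] (hp : p ≠ ∞)
    (hP : ∀ i : Fin N, N₁ ≤ (i : ℕ) → P i ≠ ∞)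
    (hPQ : ∀ i : Fin N, N₁ ≤ (i : ℕ) → (P i).HolderConjugate (Q i))
    (hqQ : ∀ i : Fin N, N₁ ≤ (i : ℕ) → q ≤ Q i) (hu : IsGradient hN P u D d) (hup : MemLpLoc u p)
    (hσ : IsDivField hN Q q σ g) (hτ : LocallyIntegrable (firstProj hN σ)) (φ : Test N) :
    Tendsto (fun n => mollDot hτ D n φ.toCc) atTop (𝓝 (transportCLM σ g u φ -
      ∑ i ∈ Finset.univ.filter (fun i : Fin N => N₁ ≤ (i : ℕ)), ∫ x, σ x i * d i x * φ x)) := by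
  have hσ' := hσ.locallyIntegrable_apply (ENNReal.HolderConjugate.one_le q p) hqQ
  have hall := tendsto_sum_integral_mul_partialDeriv_mulTest_moll hp hσ.isWeakDiv hσ.memLpLoc_div
    (hσ.memLpLoc_apply hqQ) hup hσ' φ
  have hlast (i : Fin N) (hi : i ∈ Finset.univ.filter (fun i : Fin N => N₁ ≤ (i : ℕ))) :
      Tendsto (fun n => -∫ x, u x * partialDeriv i (mulTest _ (contDiff_moll (hσ' i) n) φ) x)
        atTop (𝓝 (∫ x, σ x i * d i x * φ x)) := by
    replace hi := (Finset.mem_filter.1 hi).2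
    have := hPQ i hi
    exact tendsto_integral_mul_partialDeriv_mulTest_moll (hP i hi) (hu.memLpLoc i hi)
      (hu.isWeakPartial i hi) (hσ.memLpLoc i hi) (hσ' i) φ
  refine (hall.sub (tendsto_finsetSum _ hlast)).congr fun n => ?_
  rw [sum_eq_sum_castLE_add_sum_filter hN, add_sub_cancel_right,
    mollDot_toCc hτ D n φ fun j => hσ' (Fin.castLE hN j)]
  exact Finset.sum_congr rfl fun j _ => (hu.isRadonPartial j _).symm

theorem IsGradient.exists_isDominated [p.HolderConjugate q] (hp : p ≠ ∞)
    (hP : ∀ i : Fin N, N₁ ≤ (i : ℕ) → P i ≠ ∞)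
    (hPQ : ∀ i : Fin N, N₁ ≤ (i : ℕ) → (P i).HolderConjugate (Q i))
    (hqQ : ∀ i : Fin N, N₁ ≤ (i : ℕ) → q ≤ Q i) (hu : IsGradient hN P u D d) (hup : MemLpLoc u p)
    (hσ : IsDivField hN Q q σ g) :
    ∃ S₁ : RadonMeasure (Euc N), IsDominated volume S₁ (firstProj hN σ) D ∧ ∀ φ : Test N,
      (S₁.addDensity (hu.locallyIntegrable_restDot hσ hPQ)).toLin φ.toCc =
        transportCLM σ g u φ := by
  have hτ := hσ.memLpLoc_firstProj.locallyIntegrable le_top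
  have hlim := hu.tendsto_mollDot hp hP hPQ hqQ hup hσ hτ
  obtain ⟨S₁, hdom, hS₁⟩ := exists_isDominated_of_tendsto_mollDot hτ hσ.memLpLoc_firstProj
    fun φ => ⟨_, hlim φ⟩
  refine ⟨S₁, hdom, fun φ => ?_⟩
  rw [RadonMeasure.addDensity_apply, tendsto_nhds_unique (hS₁ φ) (hlim φ),
    integral_restDot_mul (hu.locallyIntegrable_mul hσ hPQ)]
  exact sub_add_cancel _ _

end FirstCoordinates

/-! ### Anisotropic cutoff functions -/

section UnitBump

variable (N : ℕ)

/-- A bump function equal to `1` on the unit ball and supported in the ball of radius `2`. -/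
def unitBump : ContDiffBump (0 : Euc N) := ⟨1, 2, one_pos, one_lt_two⟩

variable {N}

theorem contDiff_unitBump : ContDiff ℝ (⊤ : ℕ∞) (unitBump N) := (unitBump N).contDiff

theorem unitBump_eq_one {y : Euc N} (hy : ‖y‖ < 1) : unitBump N y = 1 :=
  (unitBump N).one_of_mem_closedBall (mem_closedBall_zero_iff.2 hy.le)

theorem partialDeriv_unitBump_eq_zero (i : Fin N) {y : Euc N} (hy : ‖y‖ < 1) :
    partialDeriv i (unitBump N) y = 0 := by
  have h : unitBump N =ᶠ[𝓝 y] fun _ => (1 : ℝ) :=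
    (unitBump N).eventuallyEq_one_of_mem_ball (mem_ball_zero_iff.2 hy)
  rw [partialDeriv, h.fderiv_eq]
  simp

theorem memLp_partialDeriv_unitBump (i : Fin N) (q : ℝ≥0∞) :
    MemLp (partialDeriv i (unitBump N)) q :=
  (contDiff_partialDeriv contDiff_unitBump i).continuous.memLp_of_hasCompactSupport
    ((unitBump N).hasCompactSupport.fderiv_apply ℝ _)

end UnitBump

section Scaling

variable {N : ℕ} (a : Fin N → ℝ) (ha : ∀ i, a i ≠ 0)

/-- The diagonal scaling `x ↦ (a i * x i)`. -/
def scaling : Euc N ≃L[ℝ] Euc N :=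
  LinearEquiv.toContinuousLinearEquiv
    { toFun := fun x => WithLp.toLp 2 fun i => a i * x i
      invFun := fun x => WithLp.toLp 2 fun i => (a i)⁻¹ * x i
      map_add' := fun x y => by ext i; simp [mul_add]
      map_smul' := fun c x => by ext i; simp [mul_left_comm]
      left_inv := fun x => by ext i; simp [ha i]
      right_inv := fun x => by ext i; simp [ha i] }

theorem scaling_apply (x : Euc N) (i : Fin N) : scaling a ha x i = a i * x i := rfl

theorem scaling_single (i : Fin N) :
    scaling a ha (EuclideanSpace.single i 1) = a i • EuclideanSpace.single i 1 := by
  ext j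
  by_cases h : j = i
  · subst h; simp [scaling_apply]
  · simp [scaling_apply, h]

theorem det_scaling : LinearMap.det (scaling a ha : Euc N →ₗ[ℝ] Euc N) = ∏ i, a i := by
  have h : (scaling a ha : Euc N →ₗ[ℝ] Euc N) = Matrix.toLpLin 2 2 (Matrix.diagonal a) := by
    ext x i
    simp [scaling_apply, Matrix.toLpLin_apply, Matrix.mulVec_diagonal]
  rw [h, Matrix.toLpLin_eq_toLin, LinearMap.det_toLin, Matrix.det_diagonal]

theorem eLpNorm_comp_scaling {f : Euc N → ℝ} {q : ℝ≥0∞} :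
    eLpNorm (fun x => f (scaling a ha x)) q volume =
      ENNReal.ofReal |(∏ i, a i)⁻¹| ^ (1 / q).toReal * eLpNorm f q volume := by
  have hdet : LinearMap.det (scaling a ha : Euc N →ₗ[ℝ] Euc N) ≠ 0 := by
    rw [det_scaling]
    exact Finset.prod_ne_zero_iff.2 fun i _ => ha i
  have hmap := Measure.map_linearMap_addHaar_eq_smul_addHaar (volume : Measure (Euc N)) hdet
  rw [det_scaling] at hmap
  have hne : ENNReal.ofReal |(∏ i, a i)⁻¹| ≠ 0 := by
    simpa [Finset.prod_eq_zero_iff] using ha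
  rw [← smul_eq_mul, ← eLpNorm_smul_measure_of_ne_zero hne, ← hmap]
  exact ((scaling a ha).toHomeomorph.measurableEmbedding.eLpNorm_map_measure).symm

/-- The bump function `unitBump` composed with a diagonal scaling. -/
def scaledBump : Test N :=
  mkTest (fun x => unitBump N (scaling a ha x)) (contDiff_unitBump.comp (scaling a ha).contDiff)
    ((unitBump N).hasCompactSupport.comp_homeomorph (scaling a ha).toHomeomorph)

theorem scaledBump_apply (x : Euc N) : scaledBump a ha x = unitBump N (scaling a ha x) := rfl

theorem abs_scaledBump_le_one (x : Euc N) : |scaledBump a ha x| ≤ 1 := by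
  rw [scaledBump_apply, abs_of_nonneg (unitBump N).nonneg]
  exact (unitBump N).le_one

theorem partialDeriv_scaledBump (i : Fin N) (x : Euc N) :
    partialDeriv i (scaledBump a ha) x = a i * partialDeriv i (unitBump N) (scaling a ha x) := by
  have h : HasFDerivAt (scaledBump a ha) _ x :=
    (contDiff_unitBump.differentiable (by simp) (scaling a ha x)).hasFDerivAt.comp x
      (scaling a ha).hasFDerivAt
  rw [partialDeriv, h.fderiv]
  simp [scaling_single, partialDeriv]

theorem eLpNorm_partialDeriv_scaledBump (i : Fin N) (q : ℝ≥0∞) :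
    eLpNorm (partialDeriv i (scaledBump a ha)) q volume =
      ENNReal.ofReal |a i| * (ENNReal.ofReal |(∏ i, a i)⁻¹| ^ (1 / q).toReal
        * eLpNorm (partialDeriv i (unitBump N)) q volume) := by
  have h : partialDeriv i (scaledBump a ha) =
      a i • fun x => partialDeriv i (unitBump N) (scaling a ha x) :=
    funext fun x => partialDeriv_scaledBump a ha i x
  rw [h, eLpNorm_const_smul, eLpNorm_comp_scaling, Real.enorm_eq_ofReal_abs]

end Scaling

section Cutoff

theorem tendsto_eLpNorm_indicator_zero {X E : Type*} [MeasurableSpace X] [NormedAddCommGroup E]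
    {μ : Measure X} {p : ℝ≥0∞} (hp : p ≠ ∞) {u : X → E} (hu : MemLp u p μ) {s : ℕ → Set X}
    (hs : ∀ n, MeasurableSet (s n)) (hlim : ∀ x, ∀ᶠ n in atTop, x ∉ s n) :
    Tendsto (fun n => eLpNorm ((s n).indicator u) p μ) atTop (𝓝 0) := by
  rcases eq_or_ne p 0 with rfl | hp0
  · simp
  have hp' : 0 < p.toReal := ENNReal.toReal_pos hp0 hp
  have hfin : ∫⁻ x, ‖u x‖ₑ ^ p.toReal ∂μ ≠ ∞ :=
    (lintegral_rpow_enorm_lt_top_of_eLpNorm_lt_top hp0 hp hu.2).ne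
  have hint : Tendsto (fun n => ∫⁻ x, ‖(s n).indicator u x‖ₑ ^ p.toReal ∂μ) atTop
      (𝓝 (∫⁻ _, 0 ∂μ)) := by
    refine tendsto_lintegral_of_dominated_convergence' (fun x => ‖u x‖ₑ ^ p.toReal)
      (fun n => (hu.1.indicator (hs n)).enorm.pow_const _) (fun n => .of_forall fun x => ?_)
      hfin (.of_forall fun x => ?_)
    · exact ENNReal.rpow_le_rpow (enorm_indicator_le_enorm_self _ _) hp'.le
    · refine tendsto_const_nhds.congr' ?_
      filter_upwards [hlim x] with n hn
      simp [hn, hp']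
  simpa [eLpNorm_eq_lintegral_rpow_enorm_toReal hp0 hp, hp'] using
    hint.ennrpow_const (1 / p.toReal)

variable {N : ℕ} {α : Fin N → ℝ}

/-- The coefficients `(n + 1) ^ (-α i)` of the anisotropic dilations. -/
def dilation (α : Fin N → ℝ) (n : ℕ) (i : Fin N) : ℝ := ((n : ℝ) + 1) ^ (-α i)

theorem dilation_pos (α : Fin N → ℝ) (n : ℕ) (i : Fin N) : 0 < dilation α n i :=
  Real.rpow_pos_of_pos (by positivity) _

theorem dilation_ne_zero (α : Fin N → ℝ) (n : ℕ) (i : Fin N) : dilation α n i ≠ 0 :=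
  (dilation_pos α n i).ne'

theorem prod_dilation (hsum : ∑ i, α i = 1) (n : ℕ) : ∏ i, dilation α n i = ((n : ℝ) + 1)⁻¹ := by
  have hn : 0 < (n : ℝ) + 1 := by positivity
  simp only [dilation]
  rw [← Real.rpow_sum_of_pos hn, Finset.sum_neg_distrib, hsum, Real.rpow_neg_one]

theorem dilation_mul_rpow (n : ℕ) (i : Fin N) : dilation α n i * ((n : ℝ) + 1) ^ α i = 1 := by
  rw [dilation, ← Real.rpow_add (by positivity), neg_add_cancel, Real.rpow_zero]

theorem eventually_norm_scaling_dilation_lt_one (hα : ∀ i, 0 < α i) (x : Euc N) :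
    ∀ᶠ n in atTop, ‖scaling (dilation α n) (dilation_ne_zero α n) x‖ < 1 := by
  have hdil (i : Fin N) : Tendsto (fun n => dilation α n i) atTop (𝓝 0) :=
    (tendsto_rpow_neg_atTop (hα i)).comp
      (tendsto_atTop_add_const_right _ _ tendsto_natCast_atTop_atTop)
  have hsq : Tendsto (fun n => ∑ i, (dilation α n i * x i) ^ 2) atTop
      (𝓝 (∑ i : Fin N, (0 * x i) ^ 2)) :=
    tendsto_finsetSum _ fun i _ => ((hdil i).mul_const _).pow 2
  have hlt : ∀ᶠ n in atTop, ∑ i, (dilation α n i * x i) ^ 2 < 1 :=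
    hsq.eventually_lt_const (by simp)
  filter_upwards [hlt] with n hn
  rw [← sq_lt_one_iff₀ (norm_nonneg _), EuclideanSpace.real_norm_sq_eq]
  exact hn

/-- The cutoff functions `x ↦ b (A_n x)`, where `b` is `unitBump` and `A_n` is the diagonal scaling
of coefficients `(n + 1) ^ (-α i)`. -/
def anisotropicCutoff (α : Fin N → ℝ) (n : ℕ) : Test N :=
  scaledBump (dilation α n) (dilation_ne_zero α n)

theorem abs_anisotropicCutoff_le_one (α : Fin N → ℝ) (n : ℕ) (x : Euc N) :
    |anisotropicCutoff α n x| ≤ 1 :=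
  abs_scaledBump_le_one _ _ x

theorem tendsto_anisotropicCutoff (hα : ∀ i, 0 < α i) (x : Euc N) :
    Tendsto (fun n => anisotropicCutoff α n x) atTop (𝓝 1) := by
  refine tendsto_const_nhds.congr' ?_
  filter_upwards [eventually_norm_scaling_dilation_lt_one hα x] with n hn
  exact (unitBump_eq_one hn).symm

theorem eLpNorm_partialDeriv_anisotropicCutoff (hα : ∀ i, 0 < α i) (hsum : ∑ i, α i = 1) (n : ℕ)
    (i : Fin N) :
    eLpNorm (partialDeriv i (anisotropicCutoff α n)) (ENNReal.ofReal (α i)⁻¹) volume =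
      eLpNorm (partialDeriv i (unitBump N)) (ENNReal.ofReal (α i)⁻¹) volume := by
  have hn : 0 < (n : ℝ) + 1 := by positivity
  have hexp : (1 / ENNReal.ofReal (α i)⁻¹).toReal = α i := by
    rw [one_div, ENNReal.toReal_inv, ENNReal.toReal_ofReal (inv_nonneg.2 (hα i).le), inv_inv]
  rw [anisotropicCutoff, eLpNorm_partialDeriv_scaledBump, prod_dilation hsum, hexp, inv_inv,
    abs_of_pos hn, abs_of_pos (dilation_pos α n i), ENNReal.ofReal_rpow_of_pos hn, ← mul_assoc,
    ← ENNReal.ofReal_mul (dilation_pos α n i).le, dilation_mul_rpow, ENNReal.ofReal_one, one_mul]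

theorem partialDeriv_anisotropicCutoff_eq_zero {n : ℕ} (i : Fin N) {x : Euc N}
    (hx : ‖scaling (dilation α n) (dilation_ne_zero α n) x‖ < 1) :
    partialDeriv i (anisotropicCutoff α n) x = 0 := by
  rw [anisotropicCutoff, partialDeriv_scaledBump, partialDeriv_unitBump_eq_zero i hx, mul_zero]

theorem tendsto_eLpNorm_mul_partialDeriv_anisotropicCutoff (hα : ∀ i, 0 < α i)
    (hsum : ∑ i, α i = 1) (i : Fin N) {p r : ℝ≥0∞} [p.HolderTriple (ENNReal.ofReal (α i)⁻¹) r]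
    (hp : p ≠ ∞) {u : Euc N → ℝ} (hu : MemLp u p volume) :
    Tendsto (fun n => eLpNorm (u * partialDeriv i (anisotropicCutoff α n)) r volume)
      atTop (𝓝 0) := by
  let far (n : ℕ) : Set (Euc N) := {x | 1 ≤ ‖scaling (dilation α n) (dilation_ne_zero α n) x‖}
  have hfar (n : ℕ) : MeasurableSet (far n) :=
    (isClosed_le continuous_const
      (scaling (dilation α n) (dilation_ne_zero α n)).continuous.norm).measurableSet
  have htail := tendsto_eLpNorm_indicator_zero hp hu hfar fun x =>
    (eventually_norm_scaling_dilation_lt_one hα x).mono fun n hn => not_le_of_gt hn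
  have hmul (n : ℕ) : u * partialDeriv i (anisotropicCutoff α n) =
      (far n).indicator u • partialDeriv i (anisotropicCutoff α n) := by
    ext x
    by_cases hx : x ∈ far n
    · simp [hx]
    · simp [partialDeriv_anisotropicCutoff_eq_zero i (not_le.1 hx)]
  have hle (n : ℕ) : eLpNorm (u * partialDeriv i (anisotropicCutoff α n)) r volume ≤
      eLpNorm ((far n).indicator u) p volume
        * eLpNorm (partialDeriv i (unitBump N)) (ENNReal.ofReal (α i)⁻¹) volume := by
    rw [hmul, ← eLpNorm_partialDeriv_anisotropicCutoff hα hsum n i]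
    exact eLpNorm_smul_le_mul_eLpNorm
      (contDiff_partialDeriv (anisotropicCutoff α n).contDiff i).continuous.aestronglyMeasurable
      (hu.1.indicator (hfar n))
  refine tendsto_of_tendsto_of_tendsto_of_le_of_le tendsto_const_nhds ?_ (fun _ => zero_le) hle
  simpa using ENNReal.Tendsto.mul_const htail (.inr (memLp_partialDeriv_unitBump i _).2.ne)

theorem tendsto_integral_mul_partialDeriv_anisotropicCutoff (hα : ∀ i, 0 < α i)
    (hsum : ∑ i, α i = 1) (i : Fin N) {p q r : ℝ≥0∞}
    [p.HolderTriple (ENNReal.ofReal (α i)⁻¹) r] [r.HolderConjugate q] (hp : p ≠ ∞)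
    {f u : Euc N → ℝ} (hf : MemLp f q volume) (hu : MemLp u p volume) :
    Tendsto (fun n => ∫ x, f x * u x * partialDeriv i (anisotropicCutoff α n) x)
      atTop (𝓝 0) := by
  have hcut (n : ℕ) :
      MemLp (partialDeriv i (anisotropicCutoff α n)) (ENNReal.ofReal (α i)⁻¹) volume := by
    rw [← coe_partialCLM]
    exact (partialCLM i _).continuous.memLp_of_hasCompactSupport (partialCLM i _).hasCompactSupport
  have hmem (n : ℕ) : MemLp (u * partialDeriv i (anisotropicCutoff α n)) r volume :=
    (hcut n).mul' hu
  have hlim : Tendsto (fun n =>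
      (eLpNorm (u * partialDeriv i (anisotropicCutoff α n)) r volume).toReal
        * (eLpNorm f q volume).toReal) atTop (𝓝 0) := by
    simpa using ((ENNReal.tendsto_toReal ENNReal.zero_ne_top).comp
      (tendsto_eLpNorm_mul_partialDeriv_anisotropicCutoff hα hsum i hp hu)).mul_const
        (eLpNorm f q volume).toReal
  refine squeeze_zero_norm (fun n => ?_) hlim
  simpa only [Pi.mul_apply, mul_comm (f _), mul_right_comm (u _), Real.norm_eq_abs] using
    abs_integral_mul_le_eLpNorm (hmem n) hf

end Cutoff

/-! ### Total mass of `σ · ∇u` -/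

section TotalMass

variable {N : ℕ}

theorem tendsto_integral_mul_of_tendsto_one {X : Type*} [MeasurableSpace X] {μ : Measure X}
    {f : X → ℝ} (hf : Integrable f μ) {φ : ℕ → X → ℝ} (hφ : ∀ n, AEStronglyMeasurable (φ n) μ)
    (hφ_le : ∀ n x, |φ n x| ≤ 1) (hlim : ∀ x, Tendsto (fun n => φ n x) atTop (𝓝 1)) :
    Tendsto (fun n => ∫ x, f x * φ n x ∂μ) atTop (𝓝 (∫ x, f x ∂μ)) := by
  refine tendsto_integral_of_dominated_convergence (fun x => ‖f x‖) (fun n => hf.1.mul (hφ n))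
    hf.norm (fun n => .of_forall fun x => ?_) (.of_forall fun x => ?_)
  · rw [norm_mul]
    exact mul_le_of_le_one_right (norm_nonneg _) (hφ_le n x)
  · simpa using (hlim x).const_mul (f x)

theorem univ_eq_neg_integral_of_signedIntegral_eq_transportCLM {α : Fin N → ℝ}
    (hα : ∀ i, 0 < α i) (hsum : ∑ i, α i = 1) {p : ℝ≥0∞} (hp : p ≠ ∞) {r : Fin N → ℝ≥0∞}
    (hpr : ∀ i, p.HolderTriple (ENNReal.ofReal (α i)⁻¹) (r i)) {σ : Euc N → Euc N}
    (hσ : ∀ i, ∃ q, (r i).HolderConjugate q ∧ MemLp (fun x => σ x i) q) {g u : Euc N → ℝ}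
    (hu : MemLp u p) (hg : Integrable fun x => g x * u x)
    (hσu : ∀ i, LocallyIntegrable fun x => σ x i * u x) {s : SignedMeasure (Euc N)}
    (hs : ∀ φ : Test N, signedIntegral s φ = transportCLM σ g u φ) :
    s univ = -∫ x, g x * u x := by
  have hmass := tendsto_signedIntegral s
    (fun n => (anisotropicCutoff α n).continuous.measurable)
    (abs_anisotropicCutoff_le_one α) (tendsto_anisotropicCutoff hα)
  rw [signedIntegral_one] at hmass
  refine tendsto_nhds_unique hmass ?_
  simp only [hs, transportCLM_apply hg.locallyIntegrable hσu, integral_dotGrad_mul hσu]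
  have hdiv := tendsto_integral_mul_of_tendsto_one hg
    (fun n => (anisotropicCutoff α n).continuous.aestronglyMeasurable)
    (abs_anisotropicCutoff_le_one α) (tendsto_anisotropicCutoff hα)
  have hgrad : Tendsto
      (fun n => ∑ i, ∫ x, σ x i * u x * partialDeriv i (anisotropicCutoff α n) x)
      atTop (𝓝 (∑ _i : Fin N, 0)) := tendsto_finsetSum _ fun i _ => by
    obtain ⟨q, hq, hσi⟩ := hσ i
    have := hpr i
    exact tendsto_integral_mul_partialDeriv_anisotropicCutoff hα hsum i (r := r i) hp hσi hu
  simpa [mul_assoc] using hdiv.neg.sub hgrad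

end TotalMass

/-! ### The spaces `BV^p` -/

section BV

variable {N N₁ : ℕ} {p : Fin N → ℝ}

theorem conj_holderConjugate {q : ℝ} (hq : 1 < q) : (ENNReal.ofReal q).HolderConjugate (conj q) :=
  (Real.HolderConjugate.conjExponent hq).ennrealOfReal

theorem conj_antitone {q r : ℝ} (hq : 1 < q) (hqr : q ≤ r) : conj r ≤ conj q := by
  refine ENNReal.ofReal_le_ofReal ?_
  rw [div_le_div_iff₀ (by linarith) (by linarith)]
  nlinarith

theorem holderTriple_inv_sub_inv {q r : ℝ} (hq : 0 < q) (hqr : q < r) :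
    (ENNReal.ofReal r).HolderTriple (ENNReal.ofReal (1 / q - 1 / r)⁻¹) (ENNReal.ofReal q) := by
  have hr : 0 < r := hq.trans hqr
  refine Real.HolderTriple.ennrealOfReal ⟨?_, hr, inv_pos.2 ?_⟩
  · rw [inv_inv, one_div, one_div, add_sub_cancel]
  · exact sub_pos.2 (one_div_lt_one_div_of_lt hq hqr)

theorem pos_of_invExp_pos (hN : N₁ ≤ N) (h : 0 < invExp N₁ p) : 0 < N := by
  rcases N.eq_zero_or_pos with rfl | hpos
  · obtain rfl : N₁ = 0 := Nat.le_zero.1 hN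
    norm_num [invExp] at h
  · exact hpos

theorem sum_inv_sub_inv_pStar (hN : N₁ ≤ N) (hp_one : ∀ i : Fin N, (i : ℕ) < N₁ → p i = 1)
    (h : 0 < invExp N₁ p) : ∑ i, (1 / p i - 1 / pStar N₁ p) = 1 := by
  have hN0 : (N : ℝ) ≠ 0 := Nat.cast_ne_zero.2 (pos_of_invExp_pos hN h).ne'
  have hfirst (j : Fin N₁) : p (Fin.castLE hN j) = 1 := hp_one _ j.2
  have hsum : ∑ i, 1 / p i = invExp N₁ p + 1 := by
    simp [sum_eq_sum_castLE_add_sum_filter hN, invExp, hfirst]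
  have hstar : (N : ℝ) * (1 / pStar N₁ p) = invExp N₁ p := by
    rw [pStar, one_div_div, mul_div_cancel₀ _ hN0]
  rw [Finset.sum_sub_distrib, hsum, Finset.sum_const, Finset.card_univ, Fintype.card_fin,
    nsmul_eq_mul, hstar, add_sub_cancel_left]

theorem one_le_of_eq_one_of_one_lt (hp_one : ∀ i : Fin N, (i : ℕ) < N₁ → p i = 1)
    (hp_gt : ∀ i : Fin N, N₁ ≤ (i : ℕ) → 1 < p i) (i : Fin N) : 1 ≤ p i :=
  (lt_or_ge (i : ℕ) N₁).elim (fun hi => (hp_one i hi).ge) fun hi => (hp_gt i hi).le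

theorem one_lt_pStar (hN : N₁ ≤ N) (hp_one : ∀ i : Fin N, (i : ℕ) < N₁ → p i = 1)
    (hp_gt : ∀ i : Fin N, N₁ ≤ (i : ℕ) → 1 < p i) (h : 0 < invExp N₁ p)
    (hp_lt : ∀ i, p i < pStar N₁ p) : 1 < pStar N₁ p :=
  let i : Fin N := ⟨0, pos_of_invExp_pos hN h⟩
  (one_le_of_eq_one_of_one_lt hp_one hp_gt i).trans_lt (hp_lt i)

variable {hN : N₁ ≤ N} {u : Euc N → ℝ}

theorem MemBVLoc.memLpLoc (hu : MemBVLoc N₁ p u) : MemLpLoc u (ENNReal.ofReal (pStar N₁ p)) :=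
  memLpLoc_of_test fun χ => (hu χ).memLp

theorem MemBVLoc.exists_isGradient (hu : MemBVLoc N₁ p u) (hpStar : 1 ≤ pStar N₁ p)
    (hp : ∀ i : Fin N, N₁ ≤ (i : ℕ) → 1 ≤ p i) :
    ∃ (D : Fin N₁ → RadonMeasure (Euc N)) (d : Fin N → Euc N → ℝ),
      IsGradient hN (fun i => ENNReal.ofReal (p i)) u D d := by
  have hul := hu.memLpLoc.locallyIntegrable (ENNReal.one_le_ofReal.2 hpStar)
  have hD (j : Fin N₁) : ∃ μ, IsRadonPartial (Fin.castLE hN j) u μ :=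
    exists_isRadonPartial hul _ fun χ => (hu χ).partial_measure _ j.2
  have hd (i : Fin N) : ∃ d : Euc N → ℝ,
      N₁ ≤ (i : ℕ) → MemLpLoc d (ENNReal.ofReal (p i)) ∧ IsWeakPartial i u d := by
    by_cases hi : N₁ ≤ (i : ℕ)
    · obtain ⟨d, hd⟩ := exists_isWeakPartial (ENNReal.one_le_ofReal.2 (hp i hi)) i
        fun χ => (hu χ).partial_memLp i hi
      exact ⟨d, fun _ => hd⟩
    · exact ⟨0, fun h => absurd h hi⟩
  choose D hD using hD
  choose d hd using hd
  exact ⟨D, d, hD, fun i hi => (hd i hi).1, fun i hi => (hd i hi).2⟩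

theorem MemBV.isBounded_of_isRadonPartial (hu : MemBV N₁ p u) {i : Fin N} (hi : (i : ℕ) < N₁)
    {μ : RadonMeasure (Euc N)} (hμ : IsRadonPartial i u μ) : μ.IsBounded := by
  obtain ⟨s, hs⟩ := hu.partial_measure i hi
  have hμs : μ.IsBoundedMeasure s :=
    RadonMeasure.isBoundedMeasure_of_test fun φ => (hμ φ).trans (hs φ).symm
  exact hμs.isBounded

theorem MemBV.memLp_of_isWeakPartial (hu : MemBV N₁ p u) {i : Fin N} (hi : N₁ ≤ (i : ℕ))
    (hp : 1 ≤ p i) {d : Euc N → ℝ} (hdl : LocallyIntegrable d) (hd : IsWeakPartial i u d) :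
    MemLp d (ENNReal.ofReal (p i)) := by
  obtain ⟨d', hd', hdw'⟩ := hu.partial_memLp i hi
  have hae := hdw'.ae_eq_of_eqOn isOpen_univ
    (hd'.locallyIntegrable (ENNReal.one_le_ofReal.2 hp)) hdl hd (eqOn_refl u univ)
  exact hd'.ae_eq (hae.mono fun x hx => hx (mem_univ x))

variable {σ : Euc N → Euc N} {D : Fin N₁ → RadonMeasure (Euc N)} {d : Fin N → Euc N → ℝ}

theorem IsGradient.integrable_restDot
    (hd : IsGradient hN (fun i => ENNReal.ofReal (p i)) u D d) (hu : MemBV N₁ p u)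
    (hp : ∀ i : Fin N, N₁ ≤ (i : ℕ) → 1 < p i)
    (hσ : ∀ i : Fin N, N₁ ≤ (i : ℕ) → MemLp (fun x => σ x i) (conj (p i))) :
    Integrable (restDot N₁ σ d) := by
  refine integrable_finsetSum _ fun i hi => ?_
  replace hi := (Finset.mem_filter.1 hi).2
  have := (conj_holderConjugate (hp i hi)).symm
  exact (hσ i hi).integrable_mul (hu.memLp_of_isWeakPartial hi (hp i hi).le
    ((hd.memLpLoc i hi).locallyIntegrable (ENNReal.one_le_ofReal.2 (hp i hi).le))
    (hd.isWeakPartial i hi))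

theorem exists_holderConjugate_memLp_apply (hp_one : ∀ i : Fin N, (i : ℕ) < N₁ → p i = 1)
    (hp_gt : ∀ i : Fin N, N₁ ≤ (i : ℕ) → 1 < p i) (hτ : MemLp (firstProj hN σ) ∞)
    (hσ : ∀ i : Fin N, N₁ ≤ (i : ℕ) → MemLp (fun x => σ x i) (conj (p i))) (i : Fin N) :
    ∃ q, (ENNReal.ofReal (p i)).HolderConjugate q ∧ MemLp (fun x => σ x i) q := by
  rcases lt_or_ge (i : ℕ) N₁ with hi | hi
  · rw [hp_one i hi, ENNReal.ofReal_one]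
    exact ⟨∞, inferInstance, memLp_apply_of_firstProj hτ hi⟩
  · exact ⟨_, conj_holderConjugate (hp_gt i hi), hσ i hi⟩

theorem MemBV.univ_eq_neg_integral (hp_one : ∀ i : Fin N, (i : ℕ) < N₁ → p i = 1)
    (hp_gt : ∀ i : Fin N, N₁ ≤ (i : ℕ) → 1 < p i) (hp_pos : 0 < invExp N₁ p)
    (hp_lt : ∀ i, p i < pStar N₁ p) (hu : MemBV N₁ p u) (hτ : MemLp (firstProj hN σ) ∞)
    (hσ : ∀ i : Fin N, N₁ ≤ (i : ℕ) → MemLp (fun x => σ x i) (conj (p i))) {g : Euc N → ℝ}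
    (hg : Integrable fun x => g x * u x) (hσu : ∀ i, LocallyIntegrable fun x => σ x i * u x)
    {s : SignedMeasure (Euc N)} (hs : ∀ φ : Test N, signedIntegral s φ = transportCLM σ g u φ) :
    s univ = -∫ x, g x * u x := by
  have hp_pos' (i : Fin N) : 0 < p i :=
    one_pos.trans_le (one_le_of_eq_one_of_one_lt hp_one hp_gt i)
  exact univ_eq_neg_integral_of_signedIntegral_eq_transportCLM
    (fun i => sub_pos.2 (one_div_lt_one_div_of_lt (hp_pos' i) (hp_lt i)))
    (sum_inv_sub_inv_pStar hN hp_one hp_pos) ENNReal.ofReal_ne_top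
    (fun i => holderTriple_inv_sub_inv (hp_pos' i) (hp_lt i))
    (exists_holderConjugate_memLp_apply hp_one hp_gt hτ hσ) hu.memLp hg hσu hs

theorem MemBV.exists_isBoundedMeasure (hp_one : ∀ i : Fin N, (i : ℕ) < N₁ → p i = 1)
    (hp_gt : ∀ i : Fin N, N₁ ≤ (i : ℕ) → 1 < p i) (hp_pos : 0 < invExp N₁ p)
    (hp_lt : ∀ i, p i < pStar N₁ p) (hu : MemBV N₁ p u)
    (hd : IsGradient hN (fun i => ENNReal.ofReal (p i)) u D d) (hτ : MemLp (firstProj hN σ) ∞)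
    (hσ : ∀ i : Fin N, N₁ ≤ (i : ℕ) → MemLp (fun x => σ x i) (conj (p i))) {g : Euc N → ℝ}
    (hg : Integrable fun x => g x * u x) (hσu : ∀ i, LocallyIntegrable fun x => σ x i * u x)
    {S₁ : RadonMeasure (Euc N)} (hdom : IsDominated volume S₁ (firstProj hN σ) D)
    {hrest : LocallyIntegrable (restDot N₁ σ d)}
    (hS : ∀ φ : Test N, (S₁.addDensity hrest).toLin φ.toCc = transportCLM σ g u φ) :
    ∃ s s₁ : SignedMeasure (Euc N), (S₁.addDensity hrest).IsBoundedMeasure s ∧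
      S₁.IsBoundedMeasure s₁ ∧ s univ = -∫ x, g x * u x := by
  have hS₁_bdd : S₁.IsBounded := hdom.isBounded (ae_norm_le_toNNReal_eLpNorm hτ) fun j =>
    hu.isBounded_of_isRadonPartial j.2 (hd.isRadonPartial j)
  have hS_bdd := hS₁_bdd.addDensity hrest (hd.integrable_restDot hu hp_gt hσ)
  obtain ⟨s₁, hs₁⟩ := hS₁_bdd.exists_isBoundedMeasure
  obtain ⟨s, hs⟩ := hS_bdd.exists_isBoundedMeasure
  exact ⟨s, s₁, hs, hs₁, hu.univ_eq_neg_integral hp_one hp_gt hp_pos hp_lt hτ hσ hg hσu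
    fun φ => (hs φ.toCc).symm.trans (hS φ)⟩

end BV

end

end AnisoBV

theorem mainTheorem4 (N N₁ : ℕ) (hN : N₁ ≤ N) (p : Fin N → ℝ)
    (hp_one : ∀ i : Fin N, (i : ℕ) < N₁ → p i = 1)
    (hp_gt : ∀ i : Fin N, N₁ ≤ (i : ℕ) → 1 < p i)
    (hp_pos : 0 < AnisoBV.invExp N₁ p)
    (hp_lt : ∀ i : Fin N, p i < AnisoBV.pStar N₁ p)
    (σ : AnisoBV.Euc N → AnisoBV.Euc N)
    (hσ_first : AnisoBV.MemLpLoc (AnisoBV.firstProj hN σ) ∞)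
    (hσ_rest : ∀ i : Fin N, N₁ ≤ (i : ℕ) →
      AnisoBV.MemLpLoc (fun x => σ x i) (AnisoBV.conj (p i)))
    (divσ : AnisoBV.Euc N → ℝ) (hdiv : AnisoBV.IsWeakDiv σ divσ)
    (hdiv_mem : AnisoBV.MemLpLoc divσ (AnisoBV.conj (AnisoBV.pStar N₁ p)))
    (u : AnisoBV.Euc N → ℝ) (hu : AnisoBV.MemBVLoc N₁ p u) :
    -- the distribution `σ · ∇u`
    ∃ T : 𝓓'((⊤ : Opens (AnisoBV.Euc N)), ℝ),
      (∀ φ : AnisoBV.Test N,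
        Integrable (fun x => divσ x * (u x * φ x)) ∧
        Integrable (fun x => AnisoBV.dotGrad σ φ x * u x) ∧
        T φ = -(∫ x, divσ x * (u x * φ x)) - ∫ x, AnisoBV.dotGrad σ φ x * u x) ∧
    -- is a Radon measure `S`
    ∃ S : AnisoBV.RadonMeasure (AnisoBV.Euc N),
      (∀ φ : AnisoBV.Test N, S.toLin φ.toCc = T φ) ∧
    -- `D = ∇₁u`, and `d i = ∂_i u` for the other indices
    ∃ D : Fin N₁ → AnisoBV.RadonMeasure (AnisoBV.Euc N),
      (∀ j : Fin N₁, AnisoBV.IsRadonPartial (Fin.castLE hN j) u (D j)) ∧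
    ∃ d : Fin N → AnisoBV.Euc N → ℝ,
      (∀ i : Fin N, N₁ ≤ (i : ℕ) →
        AnisoBV.MemLpLoc (d i) (ENNReal.ofReal (p i)) ∧ AnisoBV.IsWeakPartial i u (d i) ∧
        LocallyIntegrable (fun x => σ x i * d i x)) ∧
    -- `S₁ = σ¹ · ∇₁u`
    ∃ S₁ : AnisoBV.RadonMeasure (AnisoBV.Euc N),
      (∀ φ : C_c(AnisoBV.Euc N, ℝ), S₁.toLin φ = S.toLin φ -
        ∑ i ∈ Finset.univ.filter (fun i : Fin N => N₁ ≤ (i : ℕ)), ∫ x, σ x i * d i x * φ x) ∧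
      S₁.abs ≪ AnisoBV.totalVariation D ∧
      (∀ φ : C_c(AnisoBV.Euc N, ℝ≥0),
        ∫⁻ x, φ x ∂S₁.abs ≤
          eLpNorm (AnisoBV.firstProj hN σ) ∞ (volume.restrict (tsupport φ)) *
            ∫⁻ x, φ x ∂(AnisoBV.totalVariation D)) ∧
    -- the global statement
      (MemLp (AnisoBV.firstProj hN σ) ∞ volume →
        (∀ i : Fin N, N₁ ≤ (i : ℕ) → MemLp (fun x => σ x i) (AnisoBV.conj (p i)) volume) →
        MemLp divσ (AnisoBV.conj (AnisoBV.pStar N₁ p)) volume →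
        AnisoBV.MemBV N₁ p u →
        ∃ s s₁ : SignedMeasure (AnisoBV.Euc N),
          S.IsBoundedMeasure s ∧ S₁.IsBoundedMeasure s₁ ∧
          Integrable (fun x => divσ x * u x) ∧
          s univ = -∫ x, divσ x * u x ∧
          S₁.abs ≤ eLpNorm (AnisoBV.firstProj hN σ) ∞ volume • AnisoBV.totalVariation D) := by
  have hpStar := AnisoBV.one_lt_pStar hN hp_one hp_gt hp_pos hp_lt
  have hconj := AnisoBV.conj_holderConjugate hpStar
  have hconj' := hconj.symm
  have hPQ (i : Fin N) (hi : N₁ ≤ (i : ℕ)) := AnisoBV.conj_holderConjugate (hp_gt i hi)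
  have hqQ (i : Fin N) (hi : N₁ ≤ (i : ℕ)) := AnisoBV.conj_antitone (hp_gt i hi) (hp_lt i).le
  have hσ : AnisoBV.IsDivField hN (fun i => AnisoBV.conj (p i))
    (AnisoBV.conj (AnisoBV.pStar N₁ p)) σ divσ := ⟨hσ_first, hσ_rest, hdiv, hdiv_mem⟩
  have hdivu := hdiv_mem.locallyIntegrable_mul hu.memLpLoc
  have hσu (i : Fin N) := (hσ.memLpLoc_apply hqQ i).locallyIntegrable_mul hu.memLpLoc
  obtain ⟨D, d, hd⟩ := hu.exists_isGradient (hN := hN) hpStar.le fun i hi => (hp_gt i hi).le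
  have hσd := hd.locallyIntegrable_mul hσ hPQ
  obtain ⟨S₁, hdom, hS⟩ := hd.exists_isDominated ENNReal.ofReal_ne_top
    (fun _ _ => ENNReal.ofReal_ne_top) hPQ hqQ hu.memLpLoc hσ
  refine ⟨⟨_, (AnisoBV.transportCLM σ divσ u).cont⟩, fun φ => ⟨?_,
      AnisoBV.integrable_dotGrad_mul hσu φ, AnisoBV.transportCLM_apply hdivu hσu φ⟩, _, hS, D,
    hd.isRadonPartial, d, fun i hi => ⟨hd.memLpLoc i hi, hd.isWeakPartial i hi, hσd i hi⟩, S₁,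
    fun φ => ?_, hdom.absolutelyContinuous hσ_first,
    fun φ => hdom.lintegral_le_eLpNorm (hσ_first _ φ.hasCompactSupport),
    fun hτ hσg hg hub => ?_⟩
  · simpa only [mul_assoc] using φ.integrable_mul hdivu
  · rw [AnisoBV.RadonMeasure.addDensity_apply, AnisoBV.integral_restDot_mul hσd,
      add_sub_cancel_right]
  · have hgu := hg.integrable_mul hub.memLp
    obtain ⟨s, s₁, hs, hs₁, hmass⟩ := hub.exists_isBoundedMeasure hp_one hp_gt hp_pos hp_lt hd hτ
      hσg hgu hσu hdom hS
    exact ⟨s, s₁, hs, hs₁, hgu, hmass, hdom.abs_le_smul hτ⟩
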